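/- Let $G$ be a simple graph on $n$ vertices with adjacency matrix $A$, and let $e$ be the all-ones vector and $J$ the all-ones matrix. The walk matrix is $W(G)=[e,Ae,\dots,A^{n-1}e]$, and $G$ is controllable if $\operatorname{rank} W(G)=n$. Two graphs are generalized cospectral if they have the same adjacency spectrum and their complements have the same adjacency spectrum (with multiplicities). For an integer $n\times n$ matrix $M$, $d_n(M)$ denotes the last diagonal entry (last invariant factor) of the Smith normal form of $M$. Let $\chi(G;x)=\det(xI-A)=x^n+c_1x^{n-1}+\dots+c_n$ and let $\Delta(G)$ be its discriminant. For an odd prime $p$ let $M_p(x)$ be the polynomial $$\frac{\chi(A;x)}{\operatorname{sfp}\bigl(\gcd(\chi(A;x),\chi(A+J;x))\bigr)}$$ computed over $\mathbb F_p$, where $\chi(B;x)=\det(xI-B)$ and $\operatorname{sfp}(f)$ is the product of the distinct monic irreducible factors of $f$. For $p=2$, with $k=\lfloor n/2\rfloor$, let $M_2(x)$ be the reduction modulo $2$ of $x^k+c_2x^{k-1}+c_4x^{k-2}+\dots+c_{2k}$, multiplied by $x$ if $n$ is odd. Take the coefficients of $M_p$ in $\{0,\dots,p-1\}$ and let $s=\deg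 M_p$. The modified walk matrix is the integer matrix $$W^{(p)}(G)=\Bigl[e,Ae,\dots,A^{s-1}e,\tfrac{M_p(A)e}{p},\tfrac{A M_p(A)e}{p},\dots,\tfrac{A^{n-1-s}M_p(A)e}{p}\Bigr],$$ which is $W(G)$ if $s=n$. Put $t_p=\operatorname{ord}_p d_n(W^{(p)}(G))$. A prime $p$ is potential if $t_p\ge 1$ and either $p=2$, or $p$ is odd, $p\mid\gcd(\Delta(G),d_n(W(G)))$ and $p^2\mid\Delta(G)$. Let $L=\prod_p p^{t_p}$ over all potential primes $p$ (so $L=1$ if there are none). Let $\Omega(G)$ be the graph whose vertices are the vectors $x\in\mathbb Z^n$ with $$(W^{(p)}(G))^{T}x\equiv 0 \pmod{p^{t_p}}\ \text{for every potential prime } p,\qquad x^Tx=L^2,\qquad e^Tx=L,\qquad x^TAx=0,$$ where two vertices $\xi,\eta$ are adjacent if $\xi^T\eta=0$ and $\xi^TA\eta\in\{0,L^2\}$. Let $\mathcal C(G)$ be the set of all unlabeled graphs (isomorphism classes of graphs) generalized cospectral with $G$, including the class of $G$ itself. **Theorem.** Let $G$ be a controllable graph of order $n$. Then the maximum cliques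 of $\Omega(G)$ are exactly its cliques of order $n$, and there is a one-to-one correspondence $\varphi$ between the maximum cliques of $\Omega(G)$ and $\mathcal C(G)$. Explicitly, $\varphi$ can be chosen so that $\varphi(\{\xi_1,\dots,\xi_n\})$ is the isomorphism class of the graph with adjacency matrix $Q^TAQ$, where $Q=\frac1L[\xi_1,\dots,\xi_n]$. -/

import Mathlib

open Matrix Polynomial

namespace GenSpec

noncomputable section

/-! ### Smith normal form of an integer matrix -/

/-- `diag(d)` is the Smith normal form of the integer matrix `M`: it equals `U * M * V` for some
unimodular `U` and `V`, its entries are nonnegative, and each of them divides the following ones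
(so zeros can only stand at the end). -/
def IsSmithNormalForm {n : ℕ} (M : Matrix (Fin n) (Fin n) ℤ) (d : Fin n → ℕ) : Prop :=
  (∃ U V : Matrix (Fin n) (Fin n) ℤ, IsUnit U.det ∧ IsUnit V.det ∧
    U * M * V = Matrix.diagonal fun i => (d i : ℤ)) ∧
  ∀ i j : Fin n, i ≤ j → d i ∣ d j

open Classical in
/-- The invariant factors of `M` (every integer matrix has a unique Smith normal form, so the
`else` branch never occurs). -/
def invariantFactors {n : ℕ} (M : Matrix (Fin n) (Fin n) ℤ) : Fin n → ℕ :=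
  if h : ∃ d, IsSmithNormalForm M d then h.choose else 0

/-- The last invariant factor `d_n(M)` (with value `1` for the empty matrix). -/
def lastInvariantFactor {n : ℕ} (M : Matrix (Fin n) (Fin n) ℤ) : ℕ :=
  if h : 0 < n then invariantFactors M ⟨n - 1, Nat.sub_lt h Nat.one_pos⟩ else 1

/-! ### Graphs, walk matrices, generalized cospectrality -/

open Classical in
/-- The adjacency matrix `A(G)` over `ℤ`. -/
def adj {n : ℕ} (G : SimpleGraph (Fin n)) : Matrix (Fin n) (Fin n) ℤ := G.adjMatrix ℤ

/-- The walk matrix `W(G) = [e, Ae, …, A^(n-1) e]`. -/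
def walkMatrix {n : ℕ} (G : SimpleGraph (Fin n)) : Matrix (Fin n) (Fin n) ℤ :=
  Matrix.of fun i j => ((adj G ^ (j : ℕ)) *ᵥ 1) i

/-- `G` is controllable if `W(G)` has rank `n` (over `ℚ`). -/
def Controllable {n : ℕ} (G : SimpleGraph (Fin n)) : Prop :=
  ((walkMatrix G).map (Int.cast : ℤ → ℚ)).rank = n

/-- `G` and `H` have the same spectrum, and so do their complements.  Spectra (with
multiplicities) are compared through characteristic polynomials. -/
def GenCospectral {m n : ℕ} (G : SimpleGraph (Fin m)) (H : SimpleGraph (Fin n)) : Prop :=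
  (adj G).charpoly = (adj H).charpoly ∧ (adj Gᶜ).charpoly = (adj Hᶜ).charpoly

/-- Isomorphism of finite graphs of arbitrary order. -/
instance graphSetoid : Setoid (Σ n : ℕ, SimpleGraph (Fin n)) where
  r X Y := Nonempty (X.2 ≃g Y.2)
  iseqv := ⟨fun _ => ⟨RelIso.refl _⟩, fun ⟨f⟩ => ⟨f.symm⟩, fun ⟨f⟩ ⟨g⟩ => ⟨f.trans g⟩⟩

/-- Unlabeled finite graphs: isomorphism classes of finite graphs. -/
def UnlabeledGraph : Type := Quotient graphSetoid

/-- The isomorphism class of a labeled graph. -/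
def unlabel {n : ℕ} (G : SimpleGraph (Fin n)) : UnlabeledGraph :=
  Quotient.mk graphSetoid ⟨n, G⟩

/-- `𝒞(G)`: the unlabeled graphs generalized cospectral with `G` (the class of `G` included). -/
def cospectralClasses {n : ℕ} (G : SimpleGraph (Fin n)) : Set UnlabeledGraph :=
  {c | ∃ (m : ℕ) (H : SimpleGraph (Fin m)), unlabel H = c ∧ GenCospectral G H}

/-! ### Modified walk matrices -/

open Classical in
/-- `χ(A) / sfp(gcd(χ(A), χ(A + J)))` over the field with `p` elements, where `sfp`, the
square-free part, is the product of the distinct monic irreducible factors. -/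
def mTilde {n : ℕ} (G : SimpleGraph (Fin n)) (p : ℕ) [Fact p.Prime] : (ZMod p)[X] :=
  ((adj G).map (Int.cast : ℤ → ZMod p)).charpoly /
    UniqueFactorizationMonoid.radical
      (EuclideanDomain.gcd ((adj G).map (Int.cast : ℤ → ZMod p)).charpoly
        ((adj G).map (Int.cast : ℤ → ZMod p) + Matrix.of fun _ _ => 1).charpoly)

/-- With `χ(G) = x^n + c₁ x^(n-1) + ⋯ + c_n` and `k = ⌊n/2⌋`, this is
`x^k + c₂ x^(k-1) + c₄ x^(k-2) + ⋯ + c_(2k)`, multiplied by `x` when `n` is odd. -/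
def psi {n : ℕ} (G : SimpleGraph (Fin n)) : ℤ[X] :=
  X ^ (n % 2) * ∑ j ∈ Finset.range (n / 2 + 1),
    C ((adj G).charpoly.coeff (n - 2 * j)) * X ^ (n / 2 - j)

/-- `M_p(G; x)` over the field with `p` elements (for a prime `p`). -/
def modPoly {n : ℕ} (G : SimpleGraph (Fin n)) (p : ℕ) : (ZMod p)[X] :=
  if p = 2 then (psi G).map (Int.castRingHom (ZMod p))
  else if h : p.Prime then haveI : Fact p.Prime := ⟨h⟩; mTilde G p
  else 0

/-- `M_p(G; x)` with its coefficients taken in `{0, 1, …, p - 1}`. -/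
def modPolyInt {n : ℕ} (G : SimpleGraph (Fin n)) (p : ℕ) : ℤ[X] :=
  ∑ i ∈ (modPoly G p).support, C (((modPoly G p).coeff i).val : ℤ) * X ^ i

/-- The modified walk matrix `W^(p)(G)` for a prime `p`, with columns
`e, Ae, …, A^(s-1) e, M_p(A)e / p, A M_p(A)e / p, …, A^(n-1-s) M_p(A)e / p`, where `s = deg M_p`.
All the entries of `M_p(A)e` are divisible by `p`, so that the division is exact; for `s = n`
this is `W(G)`. -/
def modifiedWalkMatrix {n : ℕ} (G : SimpleGraph (Fin n)) (p : ℕ) : Matrix (Fin n) (Fin n) ℤ :=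
  Matrix.of fun i j =>
    if (j : ℕ) < (modPoly G p).natDegree then ((adj G ^ (j : ℕ)) *ᵥ 1) i
    else ((adj G ^ ((j : ℕ) - (modPoly G p).natDegree) * aeval (adj G) (modPolyInt G p)) *ᵥ 1) i
      / (p : ℤ)

/-! ### Potential primes, `L`, and the graph `Ω(G)` -/

/-- `t_p = ord_p (d_n(W^(p)(G)))`. -/
def tExp {n : ℕ} (G : SimpleGraph (Fin n)) (p : ℕ) : ℕ :=
  padicValNat p (lastInvariantFactor (modifiedWalkMatrix G p))

/-- The discriminant `Δ(G)` of the characteristic polynomial of `G`. -/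
def discriminant {n : ℕ} (G : SimpleGraph (Fin n)) : ℤ := (adj G).charpoly.discr

/-- The potential primes of a controllable graph `G`: the primes `p` with
`ord_p (d_n(W^(p)(G))) ≥ 1` such that either `p = 2`, or `p` is odd,
`p ∣ gcd(Δ(G), d_n(W(G)))` and `p² ∣ Δ(G)`. -/
def potentialPrimes {n : ℕ} (G : SimpleGraph (Fin n)) : Finset ℕ :=
  {p ∈ insert 2 (Int.gcd (discriminant G) (lastInvariantFactor (walkMatrix G))).primeFactors |
    (p = 2 ∨ (p : ℤ) ^ 2 ∣ discriminant G) ∧ 1 ≤ tExp G p}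

/-- `L`, the product of `p ^ t_p` over the potential primes `p`. -/
def levelBound {n : ℕ} (G : SimpleGraph (Fin n)) : ℕ :=
  ∏ p ∈ potentialPrimes G, p ^ tExp G p

/-- The integral vector `x` solves the system
`(W^(p)(G))ᵀ x ≡ 0 (mod p ^ t_p)` for all potential primes `p`, `xᵀ x = L²`, `eᵀ x = L`,
`xᵀ A(G) x = 0`. -/
def IsSolution {n : ℕ} (G : SimpleGraph (Fin n)) (x : Fin n → ℤ) : Prop :=
  (∀ p ∈ potentialPrimes G, ∀ j, (p : ℤ) ^ tExp G p ∣ ((modifiedWalkMatrix G p)ᵀ *ᵥ x) j) ∧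
  x ⬝ᵥ x = (levelBound G : ℤ) ^ 2 ∧
  1 ⬝ᵥ x = (levelBound G : ℤ) ∧
  x ⬝ᵥ (adj G *ᵥ x) = 0

/-- The vertices of `Ω(G)`. -/
abbrev OmegaVertex {n : ℕ} (G : SimpleGraph (Fin n)) : Type := {x : Fin n → ℤ // IsSolution G x}

instance {n : ℕ} (G : SimpleGraph (Fin n)) : Finite (OmegaVertex G) := by
  refine Set.Finite.to_subtype (Set.Finite.subset
    (Set.finite_Icc (fun _ => -(levelBound G : ℤ)) (fun _ => (levelBound G : ℤ))) ?_)
  rintro x ⟨-, hx, -⟩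
  have key : ∀ i, |x i| ≤ (levelBound G : ℤ) := fun i => by
    apply abs_le_of_sq_le_sq _ (by positivity)
    rw [← hx, sq]
    exact Finset.single_le_sum (f := fun k => x k * x k) (fun k _ => mul_self_nonneg _)
      (Finset.mem_univ i)
  exact ⟨fun i => (abs_le.mp (key i)).1, fun i => (abs_le.mp (key i)).2⟩

/-- The graph `Ω(G)`: distinct solutions `ξ`, `η` are adjacent when `ξᵀ η = 0` and
`ξᵀ A(G) η ∈ {0, L²}`. -/
def Omega {n : ℕ} (G : SimpleGraph (Fin n)) : SimpleGraph (OmegaVertex G) where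
  Adj ξ η := ξ ≠ η ∧ ξ.1 ⬝ᵥ η.1 = 0 ∧
    (ξ.1 ⬝ᵥ (adj G *ᵥ η.1) = 0 ∨ ξ.1 ⬝ᵥ (adj G *ᵥ η.1) = (levelBound G : ℤ) ^ 2)
  symm := ⟨by
    rintro ξ η ⟨h, h0, h1⟩
    have hs : η.1 ⬝ᵥ (adj G *ᵥ ξ.1) = ξ.1 ⬝ᵥ (adj G *ᵥ η.1) := by
      rw [Matrix.dotProduct_mulVec, dotProduct_comm, ← Matrix.mulVec_transpose]
      simp [adj]
    exact ⟨h.symm, by rw [dotProduct_comm]; exact h0, by rw [hs]; exact h1⟩⟩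
  loopless := ⟨fun _ h => h.1 rfl⟩

/-- The set of maximum cliques of `Ω(G)`. -/
abbrev MaximumClique {n : ℕ} (G : SimpleGraph (Fin n)) : Type :=
  {K : Finset (OmegaVertex G) // (Omega G).IsMaximumClique K}

/-- The rational matrix `Q = (1/L) [ξ₁, …, ξ_n]` whose columns are the given vertices of `Ω(G)`,
divided by `L`. -/
def cliqueMatrix {n : ℕ} (G : SimpleGraph (Fin n)) (ξ : Fin n → OmegaVertex G) :
    Matrix (Fin n) (Fin n) ℚ :=
  Matrix.of fun i k => ((ξ k).1 i : ℚ) / (levelBound G : ℚ)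

/-- The adjacency matrix over `ℚ`. -/
def adjRat {n : ℕ} (G : SimpleGraph (Fin n)) : Matrix (Fin n) (Fin n) ℚ :=
  (adj G).map (Int.cast : ℤ → ℚ)

end

end GenSpec

namespace GenSpec

/-! For controllable `G`, the graphs `H` generalized cospectral with `G` correspond to rational
orthogonal `Q` with `Qᵀ e = e` and `Qᵀ A Q = adj H` (`GenCospectral.exists_orthogonal`,
`genCospectral_of_orthogonal`). Such a `Q` is determined by `G` and `H`, because `Qᵀ W(G) = W(H)`
and `W(G)` is invertible. The columns of `L Q` are to be the vertices of a clique, so the core is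
that `L Q` is integral (`exists_int_levelBound_mul`).

Let a prime `p` divide a denominator of `Q`. First, `W^(p)(G)ᵀ Q = W^(p)(H)ᵀ` is integral, so by the
Smith normal form `d_n(W^(p)(G)) Q` is integral and the power of `p` is at most `p ^ t_p`.
Integrality of `W^(p)` rests on `M_p(A) e ≡ 0` mod `p`: `aeval_div_radical_gcd_mulVec` for odd `p`,
`aeval_map_psi_mulVec_one` for `p = 2`. Second, `p² ∣ Δ(G)`: if `l Q` is integral and nonzero mod
`p` with `p ∣ l`, its column space mod `p` is `A`-stable and totally isotropic. An isotropic
eigenvector belongs to a multiple root of the characteristic polynomial, and lifting this to `p²`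
gives `sq_dvd_discr_charpoly`. Hence `p` is potential.

Conversely, a clique consists of orthogonal vectors of length `L`, so it has at most `n` elements.
If it has `n`, the remaining conditions say exactly that `Qᵀ A Q` is an adjacency matrix. Reordering
a clique relabels the graph, and `H = G` shows that order `n` is attained. -/

/-! ### Existence of the Smith normal form -/

/-- Two integer matrices are equivalent if they differ by unimodular factors. -/
def UnimodularEquiv {m : Type*} [Fintype m] [DecidableEq m] (M N : Matrix m m ℤ) : Prop :=
  ∃ U V : Matrix m m ℤ, IsUnit U.det ∧ IsUnit V.det ∧ U * M * V = N

namespace UnimodularEquiv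

variable {m : Type*} [Fintype m] [DecidableEq m] {M N P : Matrix m m ℤ}

theorem refl (M : Matrix m m ℤ) : UnimodularEquiv M M := ⟨1, 1, by simp, by simp, by simp⟩

theorem trans (h : UnimodularEquiv M N) (h' : UnimodularEquiv N P) : UnimodularEquiv M P := by
  obtain ⟨U, V, hU, hV, rfl⟩ := h
  obtain ⟨U', V', hU', hV', rfl⟩ := h'
  exact ⟨U' * U, V * V', by simpa using hU'.mul hU, by simpa using hV.mul hV',
    by simp only [Matrix.mul_assoc]⟩

theorem dvd_entry {d : ℤ} (h : UnimodularEquiv M N) (hd : ∀ i j, d ∣ M i j) (i j : m) :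
    d ∣ N i j := by
  obtain ⟨U, V, -, -, rfl⟩ := h
  simp only [Matrix.mul_apply]
  exact Finset.dvd_sum fun k _ => Dvd.dvd.mul_right
    (Finset.dvd_sum fun l _ => Dvd.dvd.mul_left (hd l k) _) _

theorem mul_left {U : Matrix m m ℤ} (hU : IsUnit U.det) (M : Matrix m m ℤ) :
    UnimodularEquiv M (U * M) := ⟨U, 1, hU, by simp, by simp⟩

theorem addRow (M : Matrix m m ℤ) {i k : m} (h : i ≠ k) (c : ℤ) :
    UnimodularEquiv M (transvection k i c * M) :=
  mul_left (by rw [det_transvection_of_ne _ _ h.symm]; exact isUnit_one) M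

theorem submatrix (M : Matrix m m ℤ) (σ τ : Equiv.Perm m) :
    UnimodularEquiv M (M.submatrix σ τ) := by
  refine ⟨σ.permMatrix ℤ, τ⁻¹.permMatrix ℤ, ?_, ?_, ?_⟩
  · rw [det_permutation]; exact (Equiv.Perm.sign _).isUnit
  · rw [det_permutation]; exact (Equiv.Perm.sign _).isUnit
  · ext i j
    simp [Matrix.mul_apply, Equiv.Perm.permMatrix, PEquiv.toMatrix_apply, Equiv.toPEquiv,
      Equiv.Perm.inv_def, Equiv.eq_symm_apply, eq_comm]

theorem transpose (h : UnimodularEquiv M N) : UnimodularEquiv Mᵀ Nᵀ := by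
  obtain ⟨U, V, hU, hV, rfl⟩ := h
  exact ⟨Vᵀ, Uᵀ, by simpa using hV, by simpa using hU, by
    simp [Matrix.transpose_mul, Matrix.mul_assoc]⟩

/-- An entry of minimal absolute value among all nonzero entries of equivalent matrices divides
its column. -/
theorem dvd_col_of_minimal {i j : m}
    (hmin : ∀ P, UnimodularEquiv N P → ∀ k l, P k l ≠ 0 → (N i j).natAbs ≤ (P k l).natAbs)
    (h0 : N i j ≠ 0) (k : m) : N i j ∣ N k j := by
  by_cases hik : i = k
  · rw [hik]
  by_contra hd
  have hr : N k j % N i j ≠ 0 := fun h => hd (Int.dvd_of_emod_eq_zero h)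
  -- Division with remainder: a nonzero remainder would be a smaller nonzero entry of an equivalent
  -- matrix.
  have key : (transvection k i (-(N k j / N i j)) * N) k j = N k j % N i j := by
    rw [transvection_mul_apply_same, Int.emod_def]; ring
  have h1 := hmin _ (addRow N hik (-(N k j / N i j))) k j (by rwa [key])
  rw [key] at h1
  have h2 := Int.emod_lt_abs (N k j) h0
  have h3 := Int.emod_nonneg (N k j) h0
  rw [Int.abs_eq_natAbs] at h2
  omega

/-- The row case is the column case of the transpose. For an entry in another row `k`, adding a
multiple of row `i` makes the `(k, j)` entry equal to the minimal one, which then divides all of the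
new row `k`. -/
theorem dvd_of_minimal {i j : m}
    (hmin : ∀ P, UnimodularEquiv N P → ∀ k l, P k l ≠ 0 → (N i j).natAbs ≤ (P k l).natAbs)
    (h0 : N i j ≠ 0) (k l : m) : N i j ∣ N k l := by
  have row : ∀ (N : Matrix m m ℤ) (i : m),
      (∀ P, UnimodularEquiv N P → ∀ k l, P k l ≠ 0 → (N i j).natAbs ≤ (P k l).natAbs) →
      N i j ≠ 0 → ∀ l, N i j ∣ N i l := fun N i hN h0 l =>
    dvd_col_of_minimal (N := Nᵀ) (i := j) (j := i)
      (fun P hP k l h => hN Pᵀ (by simpa using hP.transpose) l k h) h0 l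
  by_cases hik : i = k
  · subst hik
    exact row N i hmin h0 l
  obtain ⟨q, hq⟩ := dvd_col_of_minimal hmin h0 k
  have hE := addRow N hik (1 - q)
  have key : ∀ l, (transvection k i (1 - q) * N) k l = N k l + (1 - q) * N i l := fun l =>
    transvection_mul_apply_same ..
  have hkj : (transvection k i (1 - q) * N) k j = N i j := by rw [key, hq]; ring
  have h2 := row (transvection k i (1 - q) * N) k
    (fun P hP a b h => by rw [hkj]; exact hmin P (hE.trans hP) a b h) (by rwa [hkj]) l
  rw [hkj, key] at h2
  exact (Int.dvd_add_left ((row N i hmin h0 l).mul_left _)).1 h2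

/-- A nonzero matrix is equivalent to one with a corner entry that divides all entries. -/
theorem exists_corner_dvd {n : ℕ} (M : Matrix (Fin (n + 1)) (Fin (n + 1)) ℤ) :
    ∃ N, UnimodularEquiv M N ∧ ∀ k l, N 0 0 ∣ N k l := by
  by_cases hM : M = 0
  · exact ⟨M, refl M, by simp [hM]⟩
  obtain ⟨i, j, hij⟩ : ∃ i j, M i j ≠ 0 := by
    by_contra! h
    exact hM (Matrix.ext h)
  let S : Set ℕ := {a | ∃ N, UnimodularEquiv M N ∧ ∃ i j, N i j ≠ 0 ∧ (N i j).natAbs = a}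
  have hS : S.Nonempty := ⟨_, M, refl M, i, j, hij, rfl⟩
  obtain ⟨N, hN, i, j, h0, ha⟩ := WellFounded.min_mem Nat.lt_wfRel.wf S hS
  have hdvd := dvd_of_minimal (N := N) (i := i) (j := j) (fun P hP k l h => by
    rw [ha]
    exact not_lt.1 (WellFounded.not_lt_min Nat.lt_wfRel.wf S ⟨P, hN.trans hP, k, l, h, rfl⟩)) h0
  refine ⟨N.submatrix (Equiv.swap 0 i) (Equiv.swap 0 j), hN.trans (submatrix N _ _), ?_⟩
  intro k l
  simpa using hdvd _ _

/-- Clearing the first column below a corner entry that divides it. -/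
theorem exists_clear_col {n : ℕ} (M : Matrix (Fin (n + 1)) (Fin (n + 1)) ℤ)
    (h : ∀ k, M 0 0 ∣ M k 0) :
    ∃ N, UnimodularEquiv M N ∧ N 0 = M 0 ∧ ∀ k, k ≠ 0 → N k 0 = 0 := by
  choose q hq using h
  let U : Matrix (Fin (n + 1)) (Fin (n + 1)) ℤ := Matrix.of fun i j =>
    if i = j then 1 else if j = 0 then -q i else 0
  have hU : U.det = 1 := by
    have hT : U.BlockTriangular OrderDual.toDual := by
      intro i j hij
      have hij : i < j := hij
      simp [U, hij.ne, (lt_of_le_of_lt (Fin.zero_le i) hij).ne']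
    rw [Matrix.det_of_isLowerTriangular U hT]
    simp [U]
  have hmul : ∀ k l, (U * M) k l = if k = 0 then M 0 l else M k l - q k * M 0 l := by
    intro k l
    by_cases hk : k = 0
    · subst hk
      rw [Matrix.mul_apply, Finset.sum_eq_single 0]
      · simp [U]
      · intro b _ hb; simp [U, hb, hb.symm]
      · simp
    · rw [Matrix.mul_apply, ← Finset.sum_subset (Finset.subset_univ {k, 0}),
        Finset.sum_pair hk]
      · simp [U, hk]; ring
      · intro b _ hb
        simp only [Finset.mem_insert, Finset.mem_singleton, not_or] at hb
        simp [U, hb.2, Ne.symm hb.1]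
  refine ⟨U * M, mul_left (by simp [hU]) M, ?_, ?_⟩
  · ext l; simp [hmul]
  · intro k hk
    rw [hmul, if_neg hk, hq k]; ring

theorem exists_clear {n : ℕ} (M : Matrix (Fin (n + 1)) (Fin (n + 1)) ℤ)
    (h : ∀ k l, M 0 0 ∣ M k l) :
    ∃ N, UnimodularEquiv M N ∧ N 0 0 = M 0 0 ∧ ∀ k, k ≠ 0 → N k 0 = 0 ∧ N 0 k = 0 := by
  obtain ⟨N, hN, h0, hc⟩ := exists_clear_col M fun k => h k 0
  have h00 : N 0 0 = M 0 0 := by rw [h0]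
  obtain ⟨P, hP, hP0, hPc⟩ := exists_clear_col Nᵀ fun k => by
    rw [transpose_apply, transpose_apply, h00, h0]; exact h 0 k
  refine ⟨Pᵀ, hN.trans (by simpa using hP.transpose), ?_, fun k hk => ⟨?_, ?_⟩⟩
  · rw [transpose_apply, hP0, transpose_apply, h00]
  · rw [transpose_apply, hP0, transpose_apply, hc k hk]
  · rw [transpose_apply, hPc k hk]

end UnimodularEquiv

/-- The matrix with corner `a`, zero elsewhere in the first row and column, and `M` below. -/
def borderDiag {n : ℕ} (a : ℤ) (M : Matrix (Fin n) (Fin n) ℤ) :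
    Matrix (Fin (n + 1)) (Fin (n + 1)) ℤ :=
  Matrix.of fun i j => Fin.cases (Fin.cases a (fun _ => 0) j)
    (fun i' => Fin.cases 0 (fun j' => M i' j') j) i

theorem borderDiag_mul {n : ℕ} (a b : ℤ) (M N : Matrix (Fin n) (Fin n) ℤ) :
    borderDiag a M * borderDiag b N = borderDiag (a * b) (M * N) := by
  ext i j
  refine Fin.cases ?_ (fun i => ?_) i <;> refine Fin.cases ?_ (fun j => ?_) j <;>
    simp [borderDiag, Matrix.mul_apply, Fin.sum_univ_succ]

theorem det_borderDiag {n : ℕ} (a : ℤ) (M : Matrix (Fin n) (Fin n) ℤ) :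
    (borderDiag a M).det = a * M.det := by
  rw [Matrix.det_succ_row_zero, Fin.sum_univ_succ]
  have : (borderDiag a M).submatrix Fin.succ (Fin.succAbove 0) = M := by
    ext i j; simp [borderDiag]
  rw [this]
  simp [borderDiag]

/-- A corner that divides all entries keeps dividing them under unimodular operations, hence divides
every invariant factor of the block left after clearing. -/
theorem exists_isSmithNormalForm {n : ℕ} (M : Matrix (Fin n) (Fin n) ℤ) :
    ∃ d, IsSmithNormalForm M d := by
  induction n with
  | zero => exact ⟨0, ⟨1, 1, by simp, by simp, Matrix.ext fun i => i.elim0⟩, fun i => i.elim0⟩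
  | succ n ih =>
    obtain ⟨N, hMN, hN⟩ := UnimodularEquiv.exists_corner_dvd M
    obtain ⟨P, hNP, hP0, hP⟩ := UnimodularEquiv.exists_clear N hN
    have hPdvd : ∀ k l, N 0 0 ∣ P k l := hNP.dvd_entry hN
    set R : Matrix (Fin n) (Fin n) ℤ := P.submatrix Fin.succ Fin.succ with hR
    have hPR : P = borderDiag (N 0 0) R := by
      ext i j
      refine Fin.cases ?_ (fun i => ?_) i <;> refine Fin.cases ?_ (fun j => ?_) j
      · simp [borderDiag, hP0]
      · simp [borderDiag, (hP _ (Fin.succ_ne_zero j)).2]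
      · simp [borderDiag, (hP _ (Fin.succ_ne_zero i)).1]
      · simp [borderDiag, hR]
    obtain ⟨d, ⟨U, V, hU, hV, hd⟩, hdvd⟩ := ih R
    have hRd : ∀ k, N 0 0 ∣ (d k : ℤ) := fun k => by
      have := UnimodularEquiv.dvd_entry ⟨U, V, hU, hV, hd⟩ (fun k l => hPdvd k.succ l.succ) k k
      simpa using this
    -- Invariant factors are natural numbers, so the sign of the corner is absorbed in a unit.
    obtain ⟨u, hu, hua⟩ : ∃ u : ℤ, IsUnit u ∧ u * N 0 0 = (N 0 0).natAbs := by
      rcases Int.natAbs_eq (N 0 0) with h | h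
      · exact ⟨1, isUnit_one, by rw [one_mul]; exact h⟩
      · exact ⟨-1, isUnit_one.neg, by omega⟩
    obtain ⟨U', V', hU', hV', h'⟩ := (hMN.trans hNP).trans
      (⟨borderDiag u U, borderDiag 1 V, by rw [det_borderDiag]; exact hu.mul hU,
        by rw [det_borderDiag]; exact isUnit_one.mul hV, rfl⟩ : UnimodularEquiv P _)
    refine ⟨Fin.cons (N 0 0).natAbs d, ⟨U', V', hU', hV', ?_⟩, ?_⟩
    · rw [h', hPR, borderDiag_mul, borderDiag_mul, hd, hua]
      ext i j
      refine Fin.cases ?_ (fun i => ?_) i <;> refine Fin.cases ?_ (fun j => ?_) j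
      · simp [borderDiag]
      · simp [borderDiag, Matrix.diagonal_apply, (Fin.succ_ne_zero j).symm]
      · simp [borderDiag, Matrix.diagonal_apply]
      · simp [borderDiag, Matrix.diagonal_apply]
    · intro i j
      refine Fin.cases ?_ (fun i => ?_) i <;> refine Fin.cases ?_ (fun j => ?_) j
      · simp
      · intro _
        simpa using Int.natAbs_dvd_natAbs.2 (hRd j)
      · intro h; exact absurd h (by simp)
      · intro h
        simpa using hdvd i j (by simpa using h)

theorem isSmithNormalForm_invariantFactors {n : ℕ} (M : Matrix (Fin n) (Fin n) ℤ) :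
    IsSmithNormalForm M (invariantFactors M) := by
  have h := exists_isSmithNormalForm M
  rw [invariantFactors, dif_pos h]
  exact h.choose_spec

theorem invariantFactors_dvd_last {n : ℕ} (M : Matrix (Fin n) (Fin n) ℤ) (i : Fin n) :
    invariantFactors M i ∣ lastInvariantFactor M := by
  have hn : 0 < n := i.pos
  rw [lastInvariantFactor, dif_pos hn]
  exact (isSmithNormalForm_invariantFactors M).2 _ _ (Fin.le_def.2 (by simp; omega))

theorem lastInvariantFactor_ne_zero {n : ℕ} {M : Matrix (Fin n) (Fin n) ℤ} (h : M.det ≠ 0) :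
    lastInvariantFactor M ≠ 0 := by
  rw [lastInvariantFactor]
  split_ifs with hn
  · obtain ⟨⟨U, V, hU, hV, hd⟩, -⟩ := isSmithNormalForm_invariantFactors M
    intro h0
    have := congrArg det hd
    rw [det_diagonal, Finset.prod_eq_zero (Finset.mem_univ _) (by exact_mod_cast h0), det_mul,
      det_mul] at this
    exact mul_ne_zero (mul_ne_zero hU.ne_zero h) hV.ne_zero this
  · exact one_ne_zero

/-- If `Mᵀ q` is integral, then so is `d_n(M) q`. -/
theorem exists_int_lastInvariantFactor_smul {n : ℕ} (M : Matrix (Fin n) (Fin n) ℤ)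
    (q : Fin n → ℚ) (z : Fin n → ℤ)
    (h : (M.map (Int.cast : ℤ → ℚ))ᵀ *ᵥ q = fun i => (z i : ℚ)) :
    ∃ y : Fin n → ℤ, ∀ i, (lastInvariantFactor M : ℚ) * q i = y i := by
  obtain ⟨⟨U, V, hU, hV, hd⟩, -⟩ := isSmithNormalForm_invariantFactors M
  set d := invariantFactors M
  choose c hc using invariantFactors_dvd_last M
  have hUU : Uᵀ * (U⁻¹)ᵀ = 1 := by
    rw [← transpose_mul, Matrix.nonsing_inv_mul U hU, transpose_one]
  have hcast : ∀ (A B : Matrix (Fin n) (Fin n) ℤ), (A * B).map (Int.cast : ℤ → ℚ) =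
      A.map Int.cast * B.map Int.cast := fun A B => Matrix.map_mul (f := Int.castRingHom ℚ)
  have hcv : ∀ (A : Matrix (Fin n) (Fin n) ℤ) (v : Fin n → ℤ),
      A.map (Int.cast : ℤ → ℚ) *ᵥ (fun i => (v i : ℚ)) = fun i => (((A *ᵥ v) i : ℤ) : ℚ) :=
    fun A v => by ext i; simp [Matrix.mulVec, dotProduct]
  -- From `U M V = D` follows `D y = Vᵀ z`. Each `d i` divides the last one, so the last one times
  -- `y` is integral, and `Uᵀ` carries this back to `q`.
  set y := ((U⁻¹)ᵀ.map (Int.cast : ℤ → ℚ)) *ᵥ q with hy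
  have hq : q = (Uᵀ.map (Int.cast : ℤ → ℚ)) *ᵥ y := by
    rw [hy, mulVec_mulVec, ← hcast, hUU]; simp
  have hdy : ∀ i, (d i : ℚ) * y i = ((Vᵀ *ᵥ z) i : ℤ) := by
    intro i
    have e1 : (diagonal fun i => (d i : ℤ)) = Vᵀ * (Mᵀ * Uᵀ) := by
      rw [← transpose_mul, ← transpose_mul, hd, diagonal_transpose]
    have e2 : ((diagonal fun i => (d i : ℤ)).map (Int.cast : ℤ → ℚ)) *ᵥ y =
        fun i => (((Vᵀ *ᵥ z) i : ℤ) : ℚ) := by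
      rw [e1, hcast, hcast, ← mulVec_mulVec, ← mulVec_mulVec, ← hq, ← hcv, ← h]
      rfl
    have e3 := congrFun e2 i
    rw [← e3, Matrix.diagonal_map (by simp), mulVec_diagonal]
    simp
  refine ⟨Uᵀ *ᵥ fun i => (c i : ℤ) * (Vᵀ *ᵥ z) i, fun i => ?_⟩
  have hsm : (lastInvariantFactor M : ℚ) • y = fun i => (((c i : ℤ) * (Vᵀ *ᵥ z) i : ℤ) : ℚ) := by
    ext i
    rw [Pi.smul_apply, smul_eq_mul, hc i]
    push_cast
    rw [← hdy i]; ring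
  calc (lastInvariantFactor M : ℚ) * q i = ((lastInvariantFactor M : ℚ) • q) i := rfl
    _ = _ := by
      conv_lhs => rw [hq, ← mulVec_smul, hsm, hcv]

/-! ### Singular symmetric matrices and their adjugates -/

theorem dotProduct_mulVec_comm_of_isSymm {m : Type*} [Fintype m] {R : Type*} [CommRing R]
    {M : Matrix m m R}
    (hM : M.IsSymm) (v w : m → R) : v ⬝ᵥ (M *ᵥ w) = w ⬝ᵥ (M *ᵥ v) := by
  rw [dotProduct_mulVec, ← mulVec_transpose, hM.eq, dotProduct_comm]

section Adjugate

variable {m : Type*} [Fintype m] [DecidableEq m]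

theorem map_aeval_matrix {R S : Type*} [CommRing R] [CommRing S] (f : R →+* S)
    (A : Matrix m m R) (q : R[X]) : (aeval A q).map f = aeval (A.map f) (q.map f) := by
  refine Polynomial.map_aeval_eq_aeval_map (φ := f) (ψ := f.mapMatrix) ?_ q A
  ext r i j
  simp [Matrix.algebraMap_matrix_apply, apply_ite f]

theorem aeval_mul_eq_mul_aeval {R : Type*} [CommRing R] {A B Q : Matrix m m R}
    (h : A * Q = Q * B) (q : R[X]) : aeval A q * Q = Q * aeval B q := by
  induction q using Polynomial.induction_on' with
  | add p q hp hq => rw [map_add, map_add, add_mul, mul_add, hp, hq]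
  | monomial k a =>
    have hk : A ^ k * Q = Q * B ^ k := by
      induction k with
      | zero => simp
      | succ k ih => rw [pow_succ', pow_succ', mul_assoc, ih, ← mul_assoc, h, mul_assoc]
    simp only [aeval_monomial, Algebra.algebraMap_eq_smul_one, smul_mul_assoc, one_mul,
      mul_smul_comm, hk]

theorem isSymm_aeval {R : Type*} [CommRing R] {A : Matrix m m R} (hA : A.IsSymm) (q : R[X]) :
    (aeval A q).IsSymm := by
  induction q using Polynomial.induction_on' with
  | add p q hp hq => rw [map_add]; exact hp.add hq
  | monomial k a =>
    rw [aeval_monomial, Algebra.algebraMap_eq_smul_one, smul_mul_assoc, one_mul]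
    exact (hA.pow k).smul a

/-- Let `Q(T) = (χ(T) - χ(X)) / (T - X)` over `K[X]`. Cayley–Hamilton gives `(X - A) Q(A) = χ(X)`,
so `Q(A)` is the adjugate of `X - A`; putting `X = c` turns `Q` into `χ / (T - c) = q`. -/
theorem adjugate_scalar_sub {K : Type*} [Field K] (A : Matrix m m K) {c : K} {q : K[X]}
    (hq : A.charpoly = (X - C c) * q) : (scalar m c - A).adjugate = aeval A q := by
  set χ := A.charpoly with hχ
  obtain ⟨Q, hQ⟩ := X_sub_C_dvd_sub_C_eval (a := (X : K[X])) (p := χ.map C)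
  have hev : eval X (χ.map C) = χ := by rw [eval_map, eval₂_C_X]
  rw [hev] at hQ
  set B : Matrix m m K[X] := A.map C with hB
  have h1 : aeval B (χ.map C) = 0 := by
    rw [hB, ← map_aeval_matrix, aeval_self_charpoly]; simp
  have h2 : A.charmatrix * aeval B Q = χ • (1 : Matrix m m K[X]) := by
    have := congrArg (aeval B) hQ
    rw [map_sub, h1, map_mul, map_sub, aeval_C, aeval_C, aeval_X] at this
    have e : A.charmatrix = -(B - algebraMap K[X] (Matrix m m K[X]) X) := by
      rw [neg_sub]; rfl
    rw [e, neg_mul, ← this, Algebra.algebraMap_eq_smul_one]; simp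
  have h3 : aeval B Q = A.charmatrix.adjugate := by
    have h4 := congrArg (A.charmatrix.adjugate * ·) h2
    simp only [← Matrix.mul_assoc, adjugate_mul, Matrix.mul_smul, Matrix.smul_mul,
      Matrix.one_mul, Matrix.mul_one] at h4
    exact smul_right_injective _ A.charpoly_monic.ne_zero h4
  have h5 : Q.map (evalRingHom c) = q := by
    have := congrArg (Polynomial.map (evalRingHom c)) hQ
    rw [Polynomial.map_sub, Polynomial.map_mul, Polynomial.map_sub, Polynomial.map_map,
      Polynomial.map_X, Polynomial.map_C, Polynomial.map_C] at this
    have e1 : (evalRingHom c).comp C = RingHom.id K := by ext; simp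
    have e2 : eval c χ = 0 := by rw [hq]; simp
    rw [e1, Polynomial.map_id, coe_evalRingHom, e2, eval_X, C_0, sub_zero, hq] at this
    exact (mul_left_cancel₀ (X_sub_C_ne_zero c) this).symm
  have h6 := congrArg (fun N : Matrix m m K[X] => N.map (evalRingHom c)) h3
  rw [map_aeval_matrix, h5] at h6
  have e3 : B.map (evalRingHom c) = A := by ext; simp [hB]
  have e4 : A.charmatrix.map (evalRingHom c) = scalar m c - A := by
    ext i j
    simp [charmatrix_apply, Matrix.diagonal_apply, apply_ite (eval c)]
  rw [e3] at h6
  rw [h6, ← e4]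
  exact (RingHom.map_adjugate (evalRingHom c) A.charmatrix).symm

/-- Two independent kernel vectors combine to a nonzero one with vanishing `i`-th coordinate. It is
still killed when a row is replaced by the `i`-th unit vector, so every cofactor vanishes. -/
theorem adjugate_eq_zero_of_ker {K : Type*} [Field K] {M : Matrix m m K} {v w : m → K}
    (hv : M *ᵥ v = 0) (hw : M *ᵥ w = 0) (hv0 : v ≠ 0) (hvw : ∀ k : K, w ≠ k • v) :
    M.adjugate = 0 := by
  ext i j
  rw [adjugate_apply, Matrix.zero_apply]
  obtain ⟨u, hu0, hu, hui⟩ : ∃ u : m → K, u ≠ 0 ∧ M *ᵥ u = 0 ∧ u i = 0 := by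
    by_cases hi : v i = 0
    · exact ⟨v, hv0, hv, hi⟩
    · refine ⟨w - (w i / v i) • v, sub_ne_zero.2 (hvw _), ?_, by simp [hi]⟩
      rw [mulVec_sub, mulVec_smul, hv, hw]; simp
  refine exists_mulVec_eq_zero_iff.1 ⟨u, hu0, ?_⟩
  ext k
  by_cases hk : k = j
  · subst hk
    simp [mulVec, hui]
  · have := congrFun hu k
    simpa [mulVec, updateRow_ne hk] using this

/-- The columns of the adjugate lie in the kernel. If that is the line of `v`, symmetry forces a
multiple of `v vᵀ`; if it is larger, the adjugate is zero. -/
theorem exists_adjugate_eq_smul_vecMulVec {K : Type*} [Field K] {M : Matrix m m K} (hM : M.IsSymm)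
    {v : m → K} (hv : M *ᵥ v = 0) (hv0 : v ≠ 0) : ∃ c : K, M.adjugate = c • vecMulVec v v := by
  by_cases h : ∀ w, M *ᵥ w = 0 → ∃ k : K, w = k • v
  · have hdet : M.det = 0 := exists_mulVec_eq_zero_iff.1 ⟨v, hv0, hv⟩
    have hcol : ∀ j, ∃ k : K, M.adjugate.col j = k • v := fun j => h _ (by
      have := M.mul_adjugate
      rw [hdet, zero_smul] at this
      ext i
      exact congrFun (congrFun this i) j)
    choose a ha using hcol
    have hP : ∀ i j, M.adjugate i j = a j * v i := fun i j => congrFun (ha j) i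
    obtain ⟨i₀, hi₀⟩ : ∃ i, v i ≠ 0 := by
      by_contra! h0
      exact hv0 (funext h0)
    refine ⟨a i₀ / v i₀, ?_⟩
    ext i j
    have hs : a j * v i₀ = a i₀ * v j := by rw [← hP, ← hP, hM.adjugate.apply]
    rw [hP, Matrix.smul_apply, vecMulVec_apply, smul_eq_mul]
    field_simp
    rw [mul_right_comm, hs]; ring
  · push Not at h
    obtain ⟨w, hw, hvw⟩ := h
    exact ⟨0, by rw [adjugate_eq_zero_of_ker hv hw hv0 hvw, zero_smul]⟩

/-- The adjugate is a multiple of `v vᵀ`, which settles `v ⬝ᵥ u = 0`. Otherwise a kernel vector `w`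
of `M - u uᵀ` satisfies `M w = (u ⬝ᵥ w) u`; pairing with `v` gives `u ⬝ᵥ w = 0`, so `w` is a second,
independent kernel vector of `M`. -/
theorem adjugate_mulVec_eq_zero_of_det {K : Type*} [Field K] {M : Matrix m m K} (hM : M.IsSymm)
    {u : m → K} (h : M.det = 0) (h' : (M - vecMulVec u u).det = 0) :
    M.adjugate *ᵥ u = 0 := by
  obtain ⟨v, hv0, hv⟩ := exists_mulVec_eq_zero_iff.2 h
  obtain ⟨c, hc⟩ := exists_adjugate_eq_smul_vecMulVec hM hv hv0
  by_cases hvu : v ⬝ᵥ u = 0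
  · rw [hc, smul_mulVec, vecMulVec_mulVec, hvu]; simp
  obtain ⟨w, hw0, hw⟩ := exists_mulVec_eq_zero_iff.2 h'
  rw [sub_mulVec, vecMulVec_mulVec, sub_eq_zero] at hw
  have hw' : M *ᵥ w = (u ⬝ᵥ w) • u := by rw [hw]; simp
  have h1 : (u ⬝ᵥ w) * (v ⬝ᵥ u) = 0 := by
    rw [← smul_eq_mul, ← dotProduct_smul, ← hw', dotProduct_mulVec_comm_of_isSymm hM, hv,
      dotProduct_zero]
  have h2 : u ⬝ᵥ w = 0 := (mul_eq_zero.1 h1).resolve_right hvu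
  rw [h2, zero_smul] at hw'
  have hP : M.adjugate = 0 := adjugate_eq_zero_of_ker hv hw' hv0 fun k hk => by
    rw [hk, dotProduct_smul, dotProduct_comm, smul_eq_mul] at h2
    rcases mul_eq_zero.1 h2 with h3 | h3
    · exact hw0 (by rw [hk, h3, zero_smul])
    · exact hvu h3
  rw [hP, zero_mulVec]

theorem isSymm_scalar_sub {R : Type*} [CommRing R] {A : Matrix m m R} (hA : A.IsSymm) (c : R) :
    (scalar m c - A).IsSymm := by
  rw [Matrix.IsSymm, transpose_sub, hA.eq]; simp

theorem aeval_mulVec_of_eigen {R : Type*} [CommRing R] {A : Matrix m m R} {v : m → R} {c : R}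
    (h : A *ᵥ v = c • v) (q : R[X]) : aeval A q *ᵥ v = eval c q • v := by
  induction q using Polynomial.induction_on' with
  | add p q hp hq => rw [map_add, add_mulVec, hp, hq, eval_add, add_smul]
  | monomial k a =>
    have hk : ∀ k, (A ^ k) *ᵥ v = c ^ k • v := fun k => by
      induction k with
      | zero => simp
      | succ k ih => rw [pow_succ, ← mulVec_mulVec, h, mulVec_smul, ih, smul_smul, pow_succ']
    rw [aeval_monomial, eval_monomial, Algebra.algebraMap_eq_smul_one, smul_mul_assoc, one_mul,
      smul_mulVec, hk, smul_smul]

/-- An eigenvalue with an isotropic eigenvector is a multiple root of the characteristic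
polynomial. -/
theorem eval_derivative_charpoly_eq_zero_of_isotropic {K : Type*} [Field K] {A : Matrix m m K}
    (hA : A.IsSymm) {v : m → K} {c : K} (h : A *ᵥ v = c • v) (hv0 : v ≠ 0) (hv : v ⬝ᵥ v = 0) :
    eval c (derivative A.charpoly) = 0 := by
  have hker : (scalar m c - A) *ᵥ v = 0 := by
    rw [sub_mulVec, h, scalar_apply, diagonal_const_mulVec, sub_self]
  have hroot : A.charpoly.IsRoot c := by
    rw [IsRoot, eval_charpoly]
    exact exists_mulVec_eq_zero_iff.1 ⟨v, hv0, hker⟩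
  obtain ⟨q, hq⟩ := dvd_iff_isRoot.2 hroot
  obtain ⟨k, hk⟩ := exists_adjugate_eq_smul_vecMulVec (isSymm_scalar_sub hA c) hker hv0
  -- `q(c) v = adj(c - A) v` is a multiple of `(v ⬝ᵥ v) v = 0`, and `q(c)` is the derivative of the
  -- characteristic polynomial at `c`.
  have h1 : eval c q • v = 0 := by
    rw [← aeval_mulVec_of_eigen h, ← adjugate_scalar_sub A hq, hk, smul_mulVec, vecMulVec_mulVec,
      hv]
    simp
  rw [hq, derivative_mul]
  simp [(smul_eq_zero.1 h1).resolve_right hv0]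

end Adjugate

/-! ### The polynomial `M_p` for odd `p` annihilates `e` -/

/-- Over the algebraic closure let `μ` generate the ideal of polynomials annihilating `u`, and write
`χ = μ h`. For a root `c` of the gcd, both determinants at `c` vanish, so `χ / (x - c)` annihilates
`u` by the adjugate lemmas. Hence `μ` divides it and `c` is a root of `h`. The radical `r` has
simple roots, so `r ∣ h` and `μ ∣ χ / r`. -/
theorem aeval_div_radical_gcd_mulVec {m : Type*} [Fintype m] [DecidableEq m] {F : Type*} [Field F]
    [PerfectField F] [DecidableEq F] {A : Matrix m m F} (hA : A.IsSymm) (u : m → F) :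
    aeval A (A.charpoly / UniqueFactorizationMonoid.radical
      (EuclideanDomain.gcd A.charpoly (A + vecMulVec u u).charpoly)) *ᵥ u = 0 := by
  set g := EuclideanDomain.gcd A.charpoly (A + vecMulVec u u).charpoly with hg
  set r := UniqueFactorizationMonoid.radical g with hr
  have hrχ : r ∣ A.charpoly :=
    UniqueFactorizationMonoid.radical_dvd_self.trans (EuclideanDomain.gcd_dvd_left _ _)
  have hrχ' : r ∣ (A + vecMulVec u u).charpoly :=
    UniqueFactorizationMonoid.radical_dvd_self.trans (EuclideanDomain.gcd_dvd_right _ _)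
  have hr0 : r ≠ 0 := UniqueFactorizationMonoid.radical_ne_zero
  have hsep : r.Separable := PerfectField.separable_iff_squarefree.2
    UniqueFactorizationMonoid.squarefree_radical
  set K := AlgebraicClosure F
  set f := algebraMap F K
  set B : Matrix m m K := A.map f with hB
  set e : m → K := fun i => f (u i) with he
  have hBs : B.IsSymm := by exact hA.map f
  have hBe : (A + vecMulVec u u).map f = B + vecMulVec e e := by
    ext i j; simp [hB, he, vecMulVec_apply]
  let I : Ideal K[X] :=
    { carrier := {q | aeval B q *ᵥ e = 0}
      add_mem' := fun {a b} ha hb => by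
        simp only [Set.mem_ofPred_eq] at ha hb ⊢
        rw [map_add, add_mulVec, ha, hb, add_zero]
      zero_mem' := by simp
      smul_mem' := fun c q hq => by
        simp only [Set.mem_ofPred_eq] at hq ⊢
        rw [smul_eq_mul, map_mul, ← mulVec_mulVec, hq, mulVec_zero] }
  have hI : ∀ q, q ∈ I ↔ aeval B q *ᵥ e = 0 := fun q => Iff.rfl
  obtain ⟨μ, hμ⟩ := IsPrincipalIdealRing.principal I
  have hmem : ∀ q, q ∈ I ↔ μ ∣ q := fun q => by rw [hμ]; exact Ideal.mem_span_singleton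
  have hχ0 : B.charpoly ≠ 0 := B.charpoly_monic.ne_zero
  obtain ⟨h, hh⟩ : μ ∣ B.charpoly := by
    rw [← hmem, hI, aeval_self_charpoly, zero_mulVec]
  have hμ0 : μ ≠ 0 := fun h0 => hχ0 (by rw [hh, h0, zero_mul])
  have hh0 : h ≠ 0 := fun h0 => hχ0 (by rw [hh, h0, mul_zero])
  have hroot : ∀ c, (r.map f).IsRoot c → h.IsRoot c := by
    intro c hc
    have h1 : B.charpoly.IsRoot c := hc.dvd (by
      rw [hB, charpoly_map]; exact Polynomial.map_dvd f hrχ)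
    have h2 : (B + vecMulVec e e).charpoly.IsRoot c := hc.dvd (by
      rw [← hBe, charpoly_map]; exact Polynomial.map_dvd f hrχ')
    obtain ⟨q, hq⟩ := dvd_iff_isRoot.2 h1
    rw [IsRoot, eval_charpoly] at h1 h2
    have h3 : q ∈ I := by
      rw [hI, ← adjugate_scalar_sub B hq]
      exact adjugate_mulVec_eq_zero_of_det (isSymm_scalar_sub hBs c) h1 (by rwa [sub_sub])
    obtain ⟨k, hk⟩ := (hmem q).1 h3
    rw [hk, hh, mul_left_comm] at hq
    exact dvd_iff_isRoot.1 ⟨k, mul_left_cancel₀ hμ0 hq⟩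
  have hrh : r.map f ∣ h := by
    rw [(IsAlgClosed.splits (r.map f)).dvd_iff_roots_le_roots
      (Polynomial.map_ne_zero hr0) hh0]
    rw [Multiset.le_iff_subset (nodup_roots hsep.map)]
    intro c hc
    exact (mem_roots hh0).2 (hroot c (isRoot_of_mem_roots hc))
  obtain ⟨k, hk⟩ := hrh
  obtain ⟨M, hM⟩ := hrχ
  have hdiv : A.charpoly / r = M := by rw [hM, mul_div_cancel_left₀ _ hr0]
  have hMI : M.map f ∈ I := by
    rw [hmem]
    refine ⟨k, mul_left_cancel₀ (Polynomial.map_ne_zero (f := f) hr0) ?_⟩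
    rw [← Polynomial.map_mul, ← hM, ← charpoly_map, ← hB, hh, hk]; ring
  rw [hdiv]
  rw [hI, hB, ← map_aeval_matrix] at hMI
  ext i
  apply f.injective
  have := congrFun hMI i
  rw [Pi.zero_apply, map_zero, RingHom.map_mulVec]
  exact this

/-! ### The discriminant and the level of a rational orthogonal matrix -/

section Discriminant

variable {m : Type*} [Fintype m] [DecidableEq m]

/-- Split `f` into linear factors and use `det (A - c) = (-1)^n χ(c)` at each root. -/
theorem det_aeval_eq_resultant {K : Type*} [Field K] [IsAlgClosed K] (A : Matrix m m K) (f : K[X]) :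
    (aeval A f).det = ((-1) ^ Fintype.card m) ^ f.natDegree *
      resultant f A.charpoly f.natDegree (Fintype.card m) := by
  have hf := IsAlgClosed.splits f
  have hdet : ∀ c, (A - algebraMap K (Matrix m m K) c).det =
      (-1) ^ Fintype.card m * eval c A.charpoly := fun c => by
    rw [eval_charpoly, ← det_neg, neg_sub]; rfl
  rw [resultant_eq_prod_eval f A.charpoly _ (by rw [charpoly_natDegree_eq_dim]) hf]
  conv_lhs => rw [hf.eq_prod_roots]
  rw [map_mul, det_mul, aeval_C]
  have h1 : ((algebraMap K (Matrix m m K)) f.leadingCoeff).det =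
      f.leadingCoeff ^ Fintype.card m := by
    rw [Algebra.algebraMap_eq_smul_one, det_smul, det_one, mul_one]
  have h2 : ∀ s : Multiset K, (aeval A (s.map fun a => X - C a).prod).det =
      ((-1) ^ Fintype.card m) ^ s.card * (s.map fun c => eval c A.charpoly).prod := by
    intro s
    induction s using Multiset.induction_on with
    | empty => simp
    | cons a s ih =>
      rw [Multiset.map_cons, Multiset.prod_cons, map_mul, det_mul, ih, map_sub, aeval_X, aeval_C,
        hdet, Multiset.card_cons, Multiset.map_cons, Multiset.prod_cons]
      ring
  rw [h1, h2, hf.natDegree_eq_card_roots]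
  ring

/-- Up to sign, `det χ'(A)` is the resultant of `χ'` and `χ`, that is, the discriminant; the
identity is checked over `ℂ`. -/
theorem discr_charpoly_dvd_of_dvd_det [Nonempty m] (A : Matrix m m ℤ) {d : ℤ}
    (hd : d ∣ (aeval A (derivative A.charpoly)).det) : d ∣ A.charpoly.discr := by
  have hcard : 0 < Fintype.card m := Fintype.card_pos
  have hdeg : A.charpoly.natDegree = Fintype.card m := A.charpoly_natDegree_eq_dim
  have hdeg' : (derivative A.charpoly).natDegree = Fintype.card m - 1 := by
    rw [natDegree_derivative, hdeg]
  have key : (aeval A (derivative A.charpoly)).det = ((-1) ^ Fintype.card m) ^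
      (Fintype.card m - 1) * resultant (derivative A.charpoly) A.charpoly (Fintype.card m - 1)
        (Fintype.card m) := by
    have hinj : Function.Injective (Int.castRingHom ℂ) := Int.cast_injective
    apply hinj
    rw [RingHom.map_det, RingHom.mapMatrix_apply, map_aeval_matrix, det_aeval_eq_resultant,
      natDegree_map_eq_of_injective hinj, hdeg', charpoly_map, resultant_map_map]
    simp
  have hres := resultant_deriv (f := A.charpoly) (by
    rw [← natDegree_pos_iff_degree_pos, hdeg]; exact hcard)
  rw [resultant_comm, hdeg, A.charpoly_monic.leadingCoeff, mul_one] at hres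
  have hunit : ∀ k : ℕ, IsUnit ((-1 : ℤ) ^ k) := fun k => isUnit_one.neg.pow k
  rw [key, ((hunit _).pow _).dvd_mul_left] at hd
  rw [← (hunit _).dvd_mul_left, ← hres]
  exact hd.mul_left _

/-- A term of the Leibniz formula contains either the entry `N i i` or two different factors, one
from row `i` and one from column `i`. -/
theorem dvd_sq_det_of_row_col {N : Matrix m m ℤ} {p : ℤ} {i : m} (hrow : ∀ j, p ∣ N i j)
    (hcol : ∀ j, p ∣ N j i) (hii : p ^ 2 ∣ N i i) : p ^ 2 ∣ N.det := by
  rw [det_apply]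
  refine Finset.dvd_sum fun σ _ => ?_
  rw [Units.smul_def, smul_eq_mul]
  refine Dvd.dvd.mul_left ?_ _
  by_cases hσ : σ i = i
  · refine dvd_trans ?_ (Finset.dvd_prod_of_mem _ (Finset.mem_univ i))
    rwa [hσ]
  · have hne : i ≠ σ.symm i := fun h => hσ (by rw [h, σ.apply_symm_apply, ← h])
    refine dvd_trans ?_ (Finset.prod_dvd_prod_of_subset {i, σ.symm i} _ _ (Finset.subset_univ _))
    rw [Finset.prod_pair hne, sq]
    refine mul_dvd_mul (hcol _) ?_
    rw [σ.apply_symm_apply]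
    exact hrow _

/-- Replace the `i`-th basis vector by `v`. The congruent matrix `Uᵀ D U` has row and column `i`
divisible by `p` and `i`-th diagonal entry `vᵀ D v`, while `det U = v i` is prime to `p`. -/
theorem dvd_sq_det_of_isotropic {D : Matrix m m ℤ} (hD : D.IsSymm) {p : ℤ} (hp : Prime p)
    {v : m → ℤ} {i : m} (hi : ¬ p ∣ v i) (hDv : ∀ j, p ∣ (D *ᵥ v) j)
    (hvv : p ^ 2 ∣ v ⬝ᵥ (D *ᵥ v)) : p ^ 2 ∣ D.det := by
  let U : Matrix m m ℤ := (1 : Matrix m m ℤ).updateCol i v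
  have hU : U.det = v i := by
    have := cramer_apply (1 : Matrix m m ℤ) v i
    rw [← this, cramer_one]; rfl
  have hcolU : ∀ a, U a i = v a := fun a => by simp [U]
  have hDU : ∀ a, (D * U) a i = (D *ᵥ v) a := fun a => by
    simp [Matrix.mul_apply, mulVec, dotProduct, hcolU]
  have hcol : ∀ j, p ∣ (Uᵀ * D * U) j i := fun j => by
    rw [Matrix.mul_assoc, Matrix.mul_apply]
    exact Finset.dvd_sum fun k _ => by rw [hDU]; exact (hDv k).mul_left _
  have hsymm : (Uᵀ * D * U).IsSymm := by
    rw [Matrix.IsSymm, transpose_mul, transpose_mul, transpose_transpose, hD.eq, Matrix.mul_assoc]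
  have h := dvd_sq_det_of_row_col (N := Uᵀ * D * U) (p := p) (i := i)
    (fun j => by rw [← hsymm.apply]; exact hcol j) hcol (by
      rw [Matrix.mul_assoc, Matrix.mul_apply]
      convert hvv using 1
      exact Finset.sum_congr rfl fun k _ => by rw [hDU, transpose_apply, hcolU])
  rw [det_mul, det_mul, det_transpose, hU, mul_right_comm, ← sq] at h
  exact hp.pow_dvd_of_dvd_mul_left 2 (fun h' => hi (hp.dvd_of_dvd_pow h')) h

/-- The column space of `P` is nonzero, stable under `A` and totally isotropic, so it contains an
isotropic eigenvector, whose eigenvalue is a root of `χ'`. -/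
theorem exists_mulVec_aeval_derivative_eq_zero_of_isAlgClosed {K : Type*} [Field K] [IsAlgClosed K]
    {A B P : Matrix m m K} (hA : A.IsSymm) (hP0 : P ≠ 0) (hAP : A * P = P * B)
    (hPP : Pᵀ * P = 0) :
    ∃ z, P *ᵥ z ≠ 0 ∧ aeval A (derivative A.charpoly) *ᵥ (P *ᵥ z) = 0 := by
  let R := LinearMap.range P.mulVecLin
  have hR : ∀ x ∈ R, A.mulVecLin x ∈ R := by
    rintro _ ⟨z, rfl⟩
    exact ⟨B *ᵥ z, by simp [mulVec_mulVec, hAP]⟩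
  have hnt : Nontrivial R := by
    rw [Submodule.nontrivial_iff_ne_bot]
    intro h
    apply hP0
    rw [LinearMap.range_eq_bot] at h
    ext i j
    have := congrFun (LinearMap.congr_fun h (Pi.single j 1)) i
    simpa using this
  obtain ⟨c, hc⟩ := Module.End.exists_eigenvalue (A.mulVecLin.restrict hR)
  obtain ⟨⟨_, z, rfl⟩, hv⟩ := hc.exists_hasEigenvector
  have hv0 : P *ᵥ z ≠ 0 := fun h => hv.2 (Subtype.ext h)
  have hAv : A *ᵥ (P *ᵥ z) = c • (P *ᵥ z) := congrArg Subtype.val hv.apply_eq_smul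
  refine ⟨z, hv0, ?_⟩
  have hiso : (P *ᵥ z) ⬝ᵥ (P *ᵥ z) = 0 := by
    rw [dotProduct_mulVec, ← mulVec_transpose, mulVec_mulVec, hPP, zero_mulVec, zero_dotProduct]
  rw [aeval_mulVec_of_eigen hAv, eval_derivative_charpoly_eq_zero_of_isotropic hA hAv hv0 hiso,
    zero_smul]

/-- The eigenvector may need a larger field, but the conclusion descends: if `D = χ'(A)` were
injective on the column space of `P`, some `R` would satisfy `R D P = P`, and this identity would
persist over the algebraic closure. -/
theorem exists_mulVec_aeval_derivative_eq_zero {F : Type*} [Field F]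
    {A B P : Matrix m m F} (hA : A.IsSymm) (hP0 : P ≠ 0) (hAP : A * P = P * B)
    (hPP : Pᵀ * P = 0) :
    ∃ z, P *ᵥ z ≠ 0 ∧ aeval A (derivative A.charpoly) *ᵥ (P *ᵥ z) = 0 := by
  by_contra! hcon
  set D := aeval A (derivative A.charpoly) with hD
  have hker : LinearMap.ker (D.mulVecLin ∘ₗ (LinearMap.range P.mulVecLin).subtype) = ⊥ := by
    rw [LinearMap.ker_eq_bot']
    rintro ⟨_, z, rfl⟩ hz
    by_contra h
    exact hcon z (fun h' => h (Subtype.ext h')) hz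
  obtain ⟨g, hg⟩ := LinearMap.exists_leftInverse_of_injective _ hker
  set R := LinearMap.toMatrix' ((LinearMap.range P.mulVecLin).subtype ∘ₗ g) with hR
  have hRDP : R * (D * P) = P := by
    have : ∀ z, (R * (D * P)) *ᵥ z = P *ᵥ z := fun z => by
      have h1 := LinearMap.congr_fun hg ⟨P *ᵥ z, z, rfl⟩
      have h2 : ((g (D *ᵥ (P *ᵥ z)) : LinearMap.range P.mulVecLin) : m → F) = P *ᵥ z :=
        congrArg Subtype.val h1
      rw [← mulVec_mulVec, ← mulVec_mulVec, hR, LinearMap.toMatrix'_mulVec]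
      exact h2
    ext i j
    have := congrFun (this (Pi.single j 1)) i
    simpa using this
  set f := algebraMap F (AlgebraicClosure F)
  have hmul : ∀ M N : Matrix m m F, (M * N).map f = M.map f * N.map f := fun M N =>
    Matrix.map_mul
  obtain ⟨z, hz0, hz⟩ := exists_mulVec_aeval_derivative_eq_zero_of_isAlgClosed
    (A := A.map f) (B := B.map f) (P := P.map f) (hA.map f)
    (fun h => hP0 (Matrix.map_injective f.injective (h.trans (by ext; simp))))
    (by rw [← hmul, hAP, hmul]) (by rw [← transpose_map, ← hmul, hPP]; ext; simp)
  rw [charpoly_map, derivative_map, ← map_aeval_matrix, ← hD] at hz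
  apply hz0
  rw [← hRDP, hmul, hmul, ← mulVec_mulVec, ← mulVec_mulVec, hz, mulVec_zero]

/-- If `A` and `B` are integral, `A` is symmetric and `A Q = Q B` for an integral `Q` with
`Qᵀ Q = l² I`, where `p ∣ l` and `Q` is nonzero modulo the prime `p`, then `p²` divides the
discriminant of `A`. -/
theorem sq_dvd_discr_charpoly {A B Q : Matrix m m ℤ} (hA : A.IsSymm) {l : ℤ} {p : ℕ}
    (hp : p.Prime) (hl : (p : ℤ) ∣ l) (hAQ : A * Q = Q * B) (hQQ : Qᵀ * Q = (l ^ 2) • (1 : Matrix m m ℤ))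
    {i j : m} (hQ : ¬ (p : ℤ) ∣ Q i j) : (p : ℤ) ^ 2 ∣ A.charpoly.discr := by
  have : Nonempty m := ⟨i⟩
  have : Fact p.Prime := ⟨hp⟩
  set f := Int.castRingHom (ZMod p) with hf
  have hf0 : ∀ a : ℤ, f a = 0 ↔ (p : ℤ) ∣ a := fun a => ZMod.intCast_zmod_eq_zero_iff_dvd a p
  have hmul : ∀ M N : Matrix m m ℤ, (M * N).map f = M.map f * N.map f := fun M N =>
    Matrix.map_mul
  set D := aeval A (derivative A.charpoly) with hD
  have hDs : D.IsSymm := isSymm_aeval hA _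
  obtain ⟨z', hz0, hz⟩ := exists_mulVec_aeval_derivative_eq_zero (A := A.map f) (B := B.map f)
    (P := Q.map f) (hA.map f)
    (fun h => hQ ((hf0 _).1 (congrFun (congrFun h i) j))) (by rw [← hmul, hAQ, hmul])
    (by
      rw [← transpose_map, ← hmul, hQQ]
      ext a b
      have : f l = 0 := (hf0 l).2 hl
      rw [map_apply, Matrix.smul_apply, smul_eq_mul, map_mul, map_pow, this]
      simp)
  choose z hzz using fun a => ZMod.intCast_surjective (z' a)
  have hz' : z' = f ∘ z := funext fun a => (hzz a).symm
  rw [charpoly_map, derivative_map, ← map_aeval_matrix, ← hD] at hz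
  have hQz : Q.map f *ᵥ z' = f ∘ (Q *ᵥ z) := by
    rw [hz']; ext a; exact (RingHom.map_mulVec f Q z a).symm
  rw [hQz] at hz hz0
  obtain ⟨a, ha⟩ := Function.ne_iff.1 hz0
  refine discr_charpoly_dvd_of_dvd_det A (dvd_sq_det_of_isotropic hDs
    (Nat.prime_iff_prime_int.1 hp) (v := Q *ᵥ z) (i := a) (fun h => ha ((hf0 _).2 h))
    (fun b => ?_) ?_)
  · rw [← hf0, RingHom.map_mulVec]
    exact congrFun hz b
  -- With `v = Q z` and `D Q = Q χ'(B)`, where `χ` belongs to `A`, the value `vᵀ D v` is `l²` times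
  -- an integer because `Qᵀ Q = l²`.
  · rw [dotProduct_mulVec, ← mulVec_transpose, hDs.eq, mulVec_mulVec, aeval_mul_eq_mul_aeval hAQ, ← mulVec_mulVec,
      dotProduct_comm, dotProduct_mulVec, ← mulVec_transpose, mulVec_mulVec, hQQ, smul_mulVec,
      one_mulVec, smul_dotProduct, smul_eq_mul]
    exact (pow_dvd_pow_of_dvd hl 2).mul_right _

end Discriminant

/-! ### The polynomial `M_p` annihilates `e` modulo `p` -/

theorem adj_isSymm {n : ℕ} (G : SimpleGraph (Fin n)) : (adj G).IsSymm := by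
  rw [Matrix.IsSymm, adj, SimpleGraph.transpose_adjMatrix]

theorem adj_diag {n : ℕ} (G : SimpleGraph (Fin n)) (i : Fin n) : adj G i i = 0 := by
  simp [adj]

/-- Transposition gives `χ(t) = (-1)^n χ(-t)`. -/
theorem coeff_charpoly_eq_zero_of_skew {n : ℕ} {S : Matrix (Fin n) (Fin n) ℤ} (hS : Sᵀ = -S)
    {i : ℕ} (hi : Odd (n + i)) : S.charpoly.coeff i = 0 := by
  have h : S.charpoly = C ((-1) ^ n) * S.charpoly.comp (C (-1) * X) := by
    refine Polynomial.funext fun t => ?_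
    have e : S.charpoly = (-S).charpoly := by rw [← hS, charpoly_transpose]
    conv_lhs => rw [e]
    rw [eval_charpoly, eval_mul, eval_C, eval_comp, eval_charpoly]
    have : scalar (Fin n) (eval t (C (-1) * X)) - S = -(scalar (Fin n) t - -S) := by
      simp only [eval_mul, eval_C, eval_X, scalar_apply]
      ext a b
      simp only [Matrix.sub_apply, Matrix.neg_apply, diagonal_apply]
      split_ifs <;> ring
    rw [this, det_neg, ← mul_assoc, Fintype.card_fin, ← mul_pow]
    simp
  have h2 := congrArg (coeff · i) h
  simp only [coeff_C_mul, comp_C_mul_X_coeff] at h2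
  rw [mul_comm (S.charpoly.coeff i), ← mul_assoc, ← pow_add, hi.neg_one_pow] at h2
  omega

/-- Changing signs below the diagonal makes `A` skew-symmetric without changing it modulo 2. -/
theorem two_dvd_coeff_charpoly {n : ℕ} {A : Matrix (Fin n) (Fin n) ℤ} (hA : A.IsSymm)
    (hdiag : ∀ i, A i i = 0) {i : ℕ} (hi : Odd (n + i)) :
    ((A.charpoly.coeff i : ℤ) : ZMod 2) = 0 := by
  let S : Matrix (Fin n) (Fin n) ℤ := Matrix.of fun a b => if a < b then A a b else -A a b
  have hS : Sᵀ = -S := by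
    ext a b
    simp only [S, transpose_apply, Matrix.neg_apply, of_apply]
    rcases lt_trichotomy a b with h | h | h
    · simp [h, h.not_gt, hA.apply]
    · subst h; simp [hdiag]
    · simp [h, h.not_gt, hA.apply]
  have hSA : S.map (Int.castRingHom (ZMod 2)) = A.map (Int.castRingHom (ZMod 2)) := by
    ext a b
    by_cases h : a < b <;> simp [S, h, ZMod.neg_eq_self_mod_two]
  have h1 := coeff_map (p := A.charpoly) (Int.castRingHom (ZMod 2)) i
  rw [← charpoly_map, ← hSA, charpoly_map, coeff_map, coeff_charpoly_eq_zero_of_skew hS hi] at h1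
  simpa using h1.symm

/-- Over `𝔽₂` squaring substitutes `X²` for `X`, and only the exponents of the parity of `n` survive
in the characteristic polynomial. -/
theorem map_psi_sq {n : ℕ} (G : SimpleGraph (Fin n)) :
    (psi G).map (Int.castRingHom (ZMod 2)) ^ 2 =
      X ^ (n % 2) * (adj G).charpoly.map (Int.castRingHom (ZMod 2)) := by
  have : Fact (Nat.Prime 2) := ⟨Nat.prime_two⟩
  set χ := (adj G).charpoly with hχ
  have hdeg : χ.natDegree = n := by rw [hχ, charpoly_natDegree_eq_dim, Fintype.card_fin]
  have hχ2 : χ.map (Int.castRingHom (ZMod 2)) = ∑ j ∈ Finset.range (n / 2 + 1),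
      C ((χ.coeff (n - 2 * j) : ℤ) : ZMod 2) * X ^ (n - 2 * j) := by
    ext k
    rw [coeff_map, finsetSum_coeff]
    simp only [coeff_C_mul_X_pow]
    by_cases hk : n < k
    · rw [coeff_eq_zero_of_natDegree_lt (by rwa [hdeg]), map_zero]
      exact (Finset.sum_eq_zero fun j _ => if_neg (by omega)).symm
    rcases Nat.even_or_odd (n + k) with h | h
    · obtain ⟨a, ha⟩ := h
      rw [Finset.sum_eq_single (n - a)]
      · rw [if_pos (by omega), show n - 2 * (n - a) = k by omega]; rfl
      · intro b hb hne
        rw [Finset.mem_range] at hb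
        exact if_neg (by omega)
      · intro hb
        exact absurd (Finset.mem_range.2 (by omega)) hb
    · rw [Finset.sum_eq_zero]
      · exact two_dvd_coeff_charpoly (adj_isSymm G) (adj_diag G) h
      · intro j hj
        rw [Finset.mem_range] at hj
        obtain ⟨a, ha⟩ := h
        exact if_neg (by omega)
  rw [← ZMod.expand_card, psi, hχ2, Polynomial.map_mul, Polynomial.map_pow, Polynomial.map_X,
    Polynomial.map_sum, map_mul, map_pow, expand_X, map_sum, Finset.mul_sum, Finset.mul_sum]
  refine Finset.sum_congr rfl fun j hj => ?_
  rw [Finset.mem_range] at hj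
  rw [Polynomial.map_mul, Polynomial.map_C, Polynomial.map_pow, Polynomial.map_X, map_mul,
    expand_C, map_pow, expand_X, mul_left_comm, mul_left_comm (X ^ (n % 2)), ← pow_mul, ← pow_mul,
    ← pow_add, ← pow_add]
  congr 2
  omega

/-- Over `𝔽₂` one has `v ⬝ᵥ e = v ⬝ᵥ v`. For the symmetric matrix `N = ψ(A)` this gives `w ⬝ᵥ N e =
N w ⬝ᵥ N w = w ⬝ᵥ N² w`, and `N² = A^(n % 2) χ(A) = 0`. -/
theorem aeval_map_psi_mulVec_one {n : ℕ} (G : SimpleGraph (Fin n)) :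
    aeval ((adj G).map (Int.castRingHom (ZMod 2))) ((psi G).map (Int.castRingHom (ZMod 2))) *ᵥ 1
      = 0 := by
  set A := (adj G).map (Int.castRingHom (ZMod 2)) with hA
  set q := (psi G).map (Int.castRingHom (ZMod 2)) with hq
  have hAs : A.IsSymm := (adj_isSymm G).map _
  have hMs := isSymm_aeval hAs q
  have hsq : ∀ v : Fin n → ZMod 2, v ⬝ᵥ 1 = v ⬝ᵥ v := fun v => by
    refine Finset.sum_congr rfl fun i _ => ?_
    have : ∀ a : ZMod 2, a * 1 = a * a := by decide
    exact this (v i)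
  have h0 : aeval A (q ^ 2) = 0 := by
    rw [hq, map_psi_sq, ← charpoly_map, map_mul, ← hA, aeval_self_charpoly, mul_zero]
  refine dotProduct_eq_zero _ fun w => ?_
  rw [dotProduct_comm, dotProduct_mulVec_comm_of_isSymm hMs, dotProduct_comm, hsq,
    dotProduct_mulVec_comm_of_isSymm hMs, mulVec_mulVec, ← map_mul, ← sq, h0, zero_mulVec,
    dotProduct_zero]

theorem modPoly_two {n : ℕ} (G : SimpleGraph (Fin n)) :
    modPoly G 2 = (psi G).map (Int.castRingHom (ZMod 2)) := by
  rw [modPoly, if_pos rfl]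

theorem modPoly_of_ne_two {n : ℕ} (G : SimpleGraph (Fin n)) {p : ℕ} [hp : Fact p.Prime]
    (h2 : p ≠ 2) : modPoly G p = mTilde G p := by
  rw [modPoly, if_neg h2, dif_pos hp.out]

theorem modPoly_ne_zero {n : ℕ} (G : SimpleGraph (Fin n)) {p : ℕ} (hp : p.Prime) :
    modPoly G p ≠ 0 := by
  have : Fact p.Prime := ⟨hp⟩
  by_cases h2 : p = 2
  · subst h2
    rw [modPoly_two]
    intro h
    have := map_psi_sq G
    rw [h, ← charpoly_map] at this
    exact mul_ne_zero (pow_ne_zero _ X_ne_zero) (charpoly_monic _).ne_zero (by rw [← this]; simp)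
  · rw [modPoly_of_ne_two G h2, mTilde]
    intro h
    have hdvd := UniqueFactorizationMonoid.radical_dvd_self.trans (EuclideanDomain.gcd_dvd_left
      ((adj G).map (Int.cast : ℤ → ZMod p)).charpoly
        ((adj G).map (Int.cast : ℤ → ZMod p) + Matrix.of fun _ _ => 1).charpoly)
    have h0 := EuclideanDomain.mul_div_cancel' UniqueFactorizationMonoid.radical_ne_zero hdvd
    rw [h, mul_zero] at h0
    exact (charpoly_monic _).ne_zero h0.symm

theorem aeval_modPoly_mulVec_one {n : ℕ} (G : SimpleGraph (Fin n)) {p : ℕ} (hp : p.Prime) :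
    aeval ((adj G).map (Int.castRingHom (ZMod p))) (modPoly G p) *ᵥ 1 = 0 := by
  have : Fact p.Prime := ⟨hp⟩
  by_cases h2 : p = 2
  · subst h2
    rw [modPoly_two]
    exact aeval_map_psi_mulVec_one G
  · rw [modPoly_of_ne_two G h2, mTilde]
    have h1 : (Matrix.of fun _ _ => 1 : Matrix (Fin n) (Fin n) (ZMod p)) = vecMulVec 1 1 := by
      ext; simp [vecMulVec_apply]
    rw [h1]
    classical
    convert! aeval_div_radical_gcd_mulVec ((adj_isSymm G).map (Int.castRingHom (ZMod p))) 1

theorem coeff_modPolyInt {n : ℕ} (G : SimpleGraph (Fin n)) (p i : ℕ) :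
    (modPolyInt G p).coeff i = (((modPoly G p).coeff i).val : ℤ) := by
  rw [modPolyInt, finsetSum_coeff]
  simp only [coeff_C_mul_X_pow]
  rw [Finset.sum_ite_eq]
  split_ifs with h
  · rfl
  · rw [notMem_support_iff.1 h, ZMod.val_zero, Nat.cast_zero]

theorem map_modPolyInt {n : ℕ} (G : SimpleGraph (Fin n)) (p : ℕ) [NeZero p] :
    (modPolyInt G p).map (Int.castRingHom (ZMod p)) = modPoly G p := by
  ext i
  rw [coeff_map, coeff_modPolyInt]
  simp

theorem support_modPolyInt {n : ℕ} (G : SimpleGraph (Fin n)) (p : ℕ) :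
    (modPolyInt G p).support = (modPoly G p).support := by
  ext i
  rw [mem_support_iff, mem_support_iff, coeff_modPolyInt, Ne, Nat.cast_eq_zero, ZMod.val_eq_zero]

theorem natDegree_modPolyInt {n : ℕ} (G : SimpleGraph (Fin n)) (p : ℕ) :
    (modPolyInt G p).natDegree = (modPoly G p).natDegree := by
  rw [natDegree, natDegree, degree, degree, support_modPolyInt]

theorem modPolyInt_ne_zero {n : ℕ} (G : SimpleGraph (Fin n)) {p : ℕ} (hp : p.Prime) :
    modPolyInt G p ≠ 0 := by
  rw [Ne, ← support_eq_empty, support_modPolyInt, support_eq_empty]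
  exact modPoly_ne_zero G hp

/-- This makes the integer division in `modifiedWalkMatrix` exact. -/
theorem dvd_aeval_modPolyInt_mulVec_one {n : ℕ} (G : SimpleGraph (Fin n)) {p : ℕ} (hp : p.Prime)
    (k : ℕ) (i : Fin n) :
    (p : ℤ) ∣ ((adj G ^ k * aeval (adj G) (modPolyInt G p)) *ᵥ 1) i := by
  have : Fact p.Prime := ⟨hp⟩
  have h : ∀ i, (p : ℤ) ∣ (aeval (adj G) (modPolyInt G p) *ᵥ 1) i := fun i => by
    rw [← ZMod.intCast_zmod_eq_zero_iff_dvd]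
    change Int.castRingHom (ZMod p) _ = 0
    rw [RingHom.map_mulVec, map_aeval_matrix, map_modPolyInt]
    have h1 : ⇑(Int.castRingHom (ZMod p)) ∘ (1 : Fin n → ℤ) = 1 := by ext; simp
    rw [h1]
    exact congrFun (aeval_modPoly_mulVec_one G hp) i
  rw [← mulVec_mulVec, mulVec, dotProduct]
  exact Finset.dvd_sum fun j _ => (h j).mul_left _

/-! ### Walk matrices over `ℚ` -/

/-- The matrix with columns `P_j(A) e`. -/
noncomputable def polyWalkMatrix {n : ℕ} {R : Type*} [CommRing R] (A : Matrix (Fin n) (Fin n) R)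
    (P : Fin n → R[X]) : Matrix (Fin n) (Fin n) R :=
  Matrix.of fun i j => (aeval A (P j) *ᵥ 1) i

/-- `Qᵀ P(A) e = P(B) Qᵀ e = P(B) e`. Used both to bound the denominators of `Q` and to show that
`Q` is unique. -/
theorem transpose_mul_polyWalkMatrix {n : ℕ} {R : Type*} [CommRing R]
    {A B Q : Matrix (Fin n) (Fin n) R}
    (hAQ : A * Q = Q * B) (hA : A.IsSymm) (hB : B.IsSymm) (hQe : Qᵀ *ᵥ 1 = 1) (P : Fin n → R[X]) :
    Qᵀ * polyWalkMatrix A P = polyWalkMatrix B P := by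
  ext i j
  have h : Qᵀ * aeval A (P j) = aeval B (P j) * Qᵀ := by
    have := congrArg transpose (aeval_mul_eq_mul_aeval hAQ (P j))
    rwa [transpose_mul, transpose_mul, (isSymm_aeval hA _).eq, (isSymm_aeval hB _).eq] at this
  calc (Qᵀ * polyWalkMatrix A P) i j = (Qᵀ *ᵥ (aeval A (P j) *ᵥ 1)) i := rfl
    _ = (aeval B (P j) *ᵥ 1) i := by rw [mulVec_mulVec, h, ← mulVec_mulVec, hQe]

theorem polyWalkMatrix_eq_mul {n : ℕ} {R : Type*} [CommRing R] (A : Matrix (Fin n) (Fin n) R)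
    {P : Fin n → R[X]} (hP : ∀ j, (P j).natDegree = j) :
    polyWalkMatrix A P = polyWalkMatrix A (fun j => X ^ (j : ℕ)) *
      Matrix.of fun (i j : Fin n) => (P j).coeff i := by
  ext i j
  rw [Matrix.mul_apply]
  simp only [polyWalkMatrix, of_apply]
  conv_lhs => rw [(P j).as_sum_range' n (by rw [hP]; exact j.2)]
  rw [map_sum, sum_mulVec, Finset.sum_apply, Finset.sum_range]
  refine Finset.sum_congr rfl fun k _ => ?_
  rw [aeval_monomial, Algebra.algebraMap_eq_smul_one, smul_mul_assoc, one_mul, smul_mulVec,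
    Pi.smul_apply, smul_eq_mul, aeval_X_pow, mul_comm]

/-- Passing from the powers of `X` to the `P j` is an upper triangular change of basis with the
leading coefficients on the diagonal. -/
theorem det_polyWalkMatrix_ne_zero {n : ℕ} {K : Type*} [Field K] {A : Matrix (Fin n) (Fin n) K}
    {P : Fin n → K[X]} (hP : ∀ j, (P j).natDegree = j) (hP0 : ∀ j, P j ≠ 0)
    (h : (polyWalkMatrix A fun j => X ^ (j : ℕ)).det ≠ 0) : (polyWalkMatrix A P).det ≠ 0 := by
  rw [polyWalkMatrix_eq_mul A hP, det_mul]
  refine mul_ne_zero h ?_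
  rw [det_of_isUpperTriangular]
  · refine Finset.prod_ne_zero_iff.2 fun j _ => ?_
    have := leadingCoeff_ne_zero.2 (hP0 j)
    rwa [leadingCoeff, hP] at this
  · intro i j hij
    exact coeff_eq_zero_of_natDegree_lt (by rw [hP]; exact hij)

theorem adjRat_eq {n : ℕ} (G : SimpleGraph (Fin n)) :
    adjRat G = (adj G).map (Int.castRingHom ℚ) := rfl

theorem adjRat_isSymm {n : ℕ} (G : SimpleGraph (Fin n)) : (adjRat G).IsSymm :=
  (adj_isSymm G).map _

theorem map_mulVec_one {n : ℕ} (M : Matrix (Fin n) (Fin n) ℤ) (i : Fin n) :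
    (((M *ᵥ 1) i : ℤ) : ℚ) = (M.map (Int.castRingHom ℚ) *ᵥ 1) i := by
  simp [mulVec, dotProduct]

theorem map_adj_pow {n : ℕ} (G : SimpleGraph (Fin n)) (k : ℕ) :
    (adj G ^ k).map (Int.castRingHom ℚ) = adjRat G ^ k := by
  rw [adjRat_eq]; exact map_pow (Int.castRingHom ℚ).mapMatrix (adj G) k

theorem map_walkMatrix {n : ℕ} (G : SimpleGraph (Fin n)) :
    (walkMatrix G).map (Int.cast : ℤ → ℚ) =
      polyWalkMatrix (adjRat G) (fun j => X ^ (j : ℕ)) := by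
  ext i j
  simp only [map_apply, walkMatrix, polyWalkMatrix, of_apply]
  rw [map_mulVec_one, aeval_X_pow, map_adj_pow]

/-- The polynomials `P_j` for which the columns of `W^(p)(G)` are `P_j(A) e`. -/
noncomputable def walkPoly {n : ℕ} (G : SimpleGraph (Fin n)) (p j : ℕ) : ℚ[X] :=
  if j < (modPoly G p).natDegree then X ^ j
  else C (p : ℚ)⁻¹ * (X ^ (j - (modPoly G p).natDegree) *
    (modPolyInt G p).map (Int.castRingHom ℚ))

theorem natDegree_walkPoly {n : ℕ} (G : SimpleGraph (Fin n)) {p : ℕ} (hp : p.Prime) (j : ℕ) :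
    (walkPoly G p j).natDegree = j := by
  have hM : (modPolyInt G p).map (Int.castRingHom ℚ) ≠ 0 :=
    (Polynomial.map_ne_zero_iff Int.cast_injective).2 (modPolyInt_ne_zero G hp)
  rw [walkPoly]
  split_ifs with h
  · exact natDegree_X_pow j
  · rw [natDegree_C_mul (inv_ne_zero (Nat.cast_ne_zero.2 hp.ne_zero)),
      natDegree_mul (pow_ne_zero _ X_ne_zero) hM, natDegree_X_pow,
      natDegree_map_eq_of_injective (f := Int.castRingHom ℚ) Int.cast_injective,
      natDegree_modPolyInt]
    omega

theorem walkPoly_ne_zero {n : ℕ} (G : SimpleGraph (Fin n)) {p : ℕ} (hp : p.Prime) (j : ℕ) :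
    walkPoly G p j ≠ 0 := by
  have hM : (modPolyInt G p).map (Int.castRingHom ℚ) ≠ 0 :=
    (Polynomial.map_ne_zero_iff Int.cast_injective).2 (modPolyInt_ne_zero G hp)
  rw [walkPoly]
  split_ifs with h
  · exact pow_ne_zero _ X_ne_zero
  · exact mul_ne_zero (C_ne_zero.2 (inv_ne_zero (Nat.cast_ne_zero.2 hp.ne_zero)))
      (mul_ne_zero (pow_ne_zero _ X_ne_zero) hM)

theorem map_modifiedWalkMatrix {n : ℕ} (G : SimpleGraph (Fin n)) {p : ℕ} (hp : p.Prime) :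
    (modifiedWalkMatrix G p).map (Int.cast : ℤ → ℚ) =
      polyWalkMatrix (adjRat G) (fun j => walkPoly G p j) := by
  ext i j
  simp only [map_apply, modifiedWalkMatrix, polyWalkMatrix, of_apply, walkPoly]
  split_ifs with h
  · rw [map_mulVec_one, aeval_X_pow, map_adj_pow]
  · rw [Int.cast_div (dvd_aeval_modPolyInt_mulVec_one G hp _ i)
      (by exact_mod_cast hp.ne_zero), map_mulVec_one]
    have h1 : ∀ M N : Matrix (Fin n) (Fin n) ℤ, (M * N).map (Int.castRingHom ℚ) =
        M.map (Int.castRingHom ℚ) * N.map (Int.castRingHom ℚ) := fun M N => Matrix.map_mul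
    rw [h1, map_adj_pow, map_aeval_matrix, map_mul, map_mul, aeval_C, aeval_X_pow,
      Algebra.algebraMap_eq_smul_one, smul_mul_assoc, one_mul, smul_mulVec, Pi.smul_apply,
      smul_eq_mul, ← adjRat_eq, div_eq_inv_mul]
    simp

theorem Controllable.det_ne_zero {n : ℕ} {G : SimpleGraph (Fin n)} (hG : Controllable G) :
    (polyWalkMatrix (adjRat G) fun j => X ^ (j : ℕ)).det ≠ 0 := by
  rw [← map_walkMatrix]
  intro h
  obtain ⟨v, hv0, hv⟩ := exists_mulVec_eq_zero_iff.2 h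
  have hr : ((walkMatrix G).map (Int.cast : ℤ → ℚ)).rank = n := hG
  have h1 := LinearMap.finrank_range_add_finrank_ker
    ((walkMatrix G).map (Int.cast : ℤ → ℚ)).mulVecLin
  rw [← Matrix.rank, hr, Module.finrank_fin_fun] at h1
  have h2 := Submodule.finrank_eq_zero.1 (Nat.add_eq_left.1 h1)
  have h3 : v ∈ LinearMap.ker ((walkMatrix G).map (Int.cast : ℤ → ℚ)).mulVecLin := hv
  rw [h2, Submodule.mem_bot] at h3
  exact hv0 h3

theorem det_ne_zero_of_map {n : ℕ} {M : Matrix (Fin n) (Fin n) ℤ}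
    (h : (M.map (Int.cast : ℤ → ℚ)).det ≠ 0) : M.det ≠ 0 := fun h0 => h (by
  have := (Int.castRingHom ℚ).map_det M
  rw [h0, map_zero] at this
  exact this.symm)

theorem Controllable.det_walkMatrix_ne_zero {n : ℕ} {G : SimpleGraph (Fin n)}
    (hG : Controllable G) : (walkMatrix G).det ≠ 0 :=
  det_ne_zero_of_map (by rw [map_walkMatrix]; exact hG.det_ne_zero)

theorem Controllable.det_modifiedWalkMatrix_ne_zero {n : ℕ} {G : SimpleGraph (Fin n)}
    (hG : Controllable G) {p : ℕ} (hp : p.Prime) : (modifiedWalkMatrix G p).det ≠ 0 :=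
  det_ne_zero_of_map (by
    rw [map_modifiedWalkMatrix G hp]
    exact det_polyWalkMatrix_ne_zero (fun j => natDegree_walkPoly G hp j)
      (fun j => walkPoly_ne_zero G hp j) hG.det_ne_zero)

/-! ### Generalized cospectral graphs and rational orthogonal matrices -/

section WalkSeries

variable {m : Type*} [Fintype m] [DecidableEq m] {R : Type*} [CommRing R]

theorem det_add_vecMulVec {A : Matrix m m R} (hA : IsUnit A.det) (u v : m → R) :
    (A + vecMulVec u v).det = A.det * (1 + v ⬝ᵥ (A⁻¹ *ᵥ u)) := by
  have h : A + vecMulVec u v = A * (1 + vecMulVec (A⁻¹ *ᵥ u) v) := by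
    rw [Matrix.mul_add, Matrix.mul_one, mul_vecMulVec, mulVec_mulVec, mul_nonsing_inv _ hA,
      one_mulVec]
  rw [h, det_mul, vecMulVec_eq Unit, det_one_add_replicateCol_mul_replicateRow]

/-- The matrix `1 - x A` over the power series ring. -/
noncomputable def oneSubXMul (A : Matrix m m R) : Matrix m m (PowerSeries R) :=
  1 - (PowerSeries.X : PowerSeries R) • A.map (PowerSeries.C (R := R))

theorem det_oneSubXMul (A : Matrix m m R) :
    (oneSubXMul A).det = (A.charpoly.reverse : PowerSeries R) := by
  rw [reverse_charpoly, charpolyRev, ← Polynomial.coeToPowerSeries.ringHom_apply,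
    RingHom.map_det]
  congr 1
  refine Matrix.ext fun i j => ?_
  by_cases h : i = j <;> simp [oneSubXMul, h, PowerSeries.X_mul]

theorem isUnit_det_oneSubXMul (A : Matrix m m R) : IsUnit (oneSubXMul A).det := by
  rw [PowerSeries.isUnit_iff_constantCoeff, det_oneSubXMul, reverse_charpoly]
  have h : eval 0 A.charpolyRev = 1 := eval_charpolyRev
  rw [← coeff_zero_eq_eval_zero] at h
  rw [Polynomial.constantCoeff_coe, h]
  exact isUnit_one

/-- The generating function of the numbers of walks. -/
noncomputable def walkSeries (A : Matrix m m R) : PowerSeries R :=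
  1 ⬝ᵥ ((oneSubXMul A)⁻¹ *ᵥ 1)

/-- The vector `v = (1 - x A)⁻¹ e` satisfies `v = e + x A v`, a recursion for its coefficients. -/
theorem coeff_walkSeries (A : Matrix m m R) (k : ℕ) :
    PowerSeries.coeff k (walkSeries A) = 1 ⬝ᵥ (A ^ k *ᵥ 1) := by
  set v := (oneSubXMul A)⁻¹ *ᵥ (1 : m → PowerSeries R) with hv
  have h1 : v - (PowerSeries.X : PowerSeries R) • (A.map (PowerSeries.C (R := R)) *ᵥ v) = 1 := by
    have : oneSubXMul A *ᵥ v = 1 := by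
      rw [hv, mulVec_mulVec, mul_nonsing_inv _ (isUnit_det_oneSubXMul A), one_mulVec]
    rwa [oneSubXMul, sub_mulVec, one_mulVec, smul_mulVec] at this
  have h2 : ∀ k, (fun i => PowerSeries.coeff k (v i)) = A ^ k *ᵥ 1 := by
    intro k
    induction k with
    | zero =>
      ext i
      have := congrArg (PowerSeries.coeff 0) (congrFun h1 i)
      simpa using this
    | succ k ih =>
      ext i
      have := congrArg (PowerSeries.coeff (k + 1)) (congrFun h1 i)
      rw [Pi.sub_apply, Pi.smul_apply, smul_eq_mul, map_sub, PowerSeries.coeff_succ_X_mul,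
        Pi.one_apply, PowerSeries.coeff_one, if_neg (Nat.succ_ne_zero k), sub_eq_zero] at this
      rw [this, pow_succ', ← mulVec_mulVec, ← ih]
      simp [mulVec, dotProduct]
  rw [← h2, walkSeries, ← hv]
  simp [dotProduct]

/-- `1 - x (A - J)` is the rank-one perturbation `(1 - x A) + (x e) eᵀ`. Thus the two characteristic
polynomials determine all walk counts. -/
theorem det_oneSubXMul_sub (A : Matrix m m R) :
    (oneSubXMul (A - Matrix.of fun _ _ => 1)).det =
      (oneSubXMul A).det * (1 + PowerSeries.X * walkSeries A) := by
  have h : oneSubXMul (A - Matrix.of fun _ _ => 1) =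
      oneSubXMul A + vecMulVec ((PowerSeries.X : PowerSeries R) • 1) 1 := by
    refine Matrix.ext fun i j => ?_
    simp [oneSubXMul, mul_sub]
    ring
  rw [h, det_add_vecMulVec (isUnit_det_oneSubXMul A), mulVec_smul, dotProduct_smul, smul_eq_mul,
    walkSeries]

/-- Matrices `A`, `B` such that `A`, `B` and `A - J`, `B - J` have the same characteristic
polynomials have the same numbers `eᵀ A^k e`. -/
theorem dotProduct_pow_mulVec_one_eq [IsDomain R] {A B : Matrix m m R}
    (h : A.charpoly = B.charpoly)
    (h' : (A - Matrix.of fun _ _ => 1).charpoly = (B - Matrix.of fun _ _ => 1).charpoly) (k : ℕ) :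
    (1 : m → R) ⬝ᵥ (A ^ k *ᵥ 1) = 1 ⬝ᵥ (B ^ k *ᵥ 1) := by
  rw [← coeff_walkSeries, ← coeff_walkSeries]
  have h1 := det_oneSubXMul_sub A
  rw [det_oneSubXMul, h', ← det_oneSubXMul, det_oneSubXMul_sub B, det_oneSubXMul, det_oneSubXMul,
    h] at h1
  have h2 := mul_left_cancel₀ (by
    rw [← det_oneSubXMul]; exact (isUnit_det_oneSubXMul B).ne_zero) h1
  rw [mul_left_cancel₀ PowerSeries.X_ne_zero (add_left_cancel h2)]

end WalkSeries

theorem adj_compl {n : ℕ} (G : SimpleGraph (Fin n)) :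
    adj Gᶜ = Matrix.of (fun _ _ => 1) - 1 - adj G := by
  ext i j
  by_cases h : i = j
  · subst h; simp [adj]
  · by_cases h' : G.Adj i j <;> simp [adj, h, h']

theorem GenCospectral.charpoly_sub_eq {n : ℕ} {G H : SimpleGraph (Fin n)}
    (h : GenCospectral G H) :
    (adj G - Matrix.of fun _ _ => 1).charpoly = (adj H - Matrix.of fun _ _ => 1).charpoly := by
  have key : ∀ G : SimpleGraph (Fin n), ∀ t, eval t (adj G - Matrix.of fun _ _ => 1).charpoly =
      (-1) ^ n * eval (-t - 1) (adj Gᶜ).charpoly := fun G t => by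
    have : scalar (Fin n) t - (adj G - Matrix.of fun _ _ => 1) =
        -(scalar (Fin n) (-t - 1) - adj Gᶜ) := by
      rw [adj_compl]
      ext a b
      simp only [scalar_apply, Matrix.sub_apply, Matrix.neg_apply, diagonal_apply,
        Matrix.one_apply, of_apply]
      split_ifs <;> ring
    rw [eval_charpoly, eval_charpoly, this, det_neg, Fintype.card_fin]
  exact Polynomial.funext fun t => by rw [key, key, h.2]

theorem transpose_polyWalkMatrix_mul_self {n : ℕ} {R : Type*} [CommRing R]
    {A : Matrix (Fin n) (Fin n) R} (hA : A.IsSymm) (i j : Fin n) :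
    ((polyWalkMatrix A fun j => X ^ (j : ℕ))ᵀ * polyWalkMatrix A fun j => X ^ (j : ℕ)) i j =
      1 ⬝ᵥ (A ^ ((i : ℕ) + j) *ᵥ 1) := by
  calc _ = (A ^ (i : ℕ) *ᵥ 1) ⬝ᵥ (A ^ (j : ℕ) *ᵥ 1) := by
        simp only [Matrix.mul_apply, transpose_apply, polyWalkMatrix, of_apply, aeval_X_pow]
        rfl
    _ = _ := by
      rw [dotProduct_mulVec_comm_of_isSymm (hA.pow _), mulVec_mulVec, ← pow_add, add_comm]

theorem map_dotProduct_pow {n : ℕ} (G : SimpleGraph (Fin n)) (k : ℕ) :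
    (1 : Fin n → ℚ) ⬝ᵥ (adjRat G ^ k *ᵥ 1) = ((1 ⬝ᵥ (adj G ^ k *ᵥ 1) : ℤ) : ℚ) := by
  rw [← map_adj_pow, dotProduct, dotProduct, Int.cast_sum]
  refine Finset.sum_congr rfl fun i _ => ?_
  rw [Int.cast_mul, map_mulVec_one]
  simp

theorem charpoly_adjRat {n : ℕ} (G : SimpleGraph (Fin n)) :
    (adjRat G).charpoly = (adj G).charpoly.map (Int.castRingHom ℚ) := by
  rw [adjRat_eq, charpoly_map]

/-- `W(G)ᵀ W(G)` is the matrix of walk counts `eᵀ A^(i+j) e`, which generalized cospectral graphs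
share; hence `Q = W(G) W(H)⁻¹` is orthogonal. -/
theorem GenCospectral.exists_orthogonal {n : ℕ} {G H : SimpleGraph (Fin n)}
    (h : GenCospectral G H) (hG : Controllable G) :
    ∃ Q : Matrix (Fin n) (Fin n) ℚ, Qᵀ * Q = 1 ∧ Qᵀ *ᵥ 1 = 1 ∧ adjRat G * Q = Q * adjRat H := by
  set A := adjRat G
  set B := adjRat H
  have hA : A.IsSymm := adjRat_isSymm G
  have hB : B.IsSymm := adjRat_isSymm H
  have hχ : A.charpoly = B.charpoly := by rw [charpoly_adjRat, charpoly_adjRat, h.1]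
  set U := polyWalkMatrix A fun j => X ^ (j : ℕ) with hU
  set V := polyWalkMatrix B fun j => X ^ (j : ℕ) with hV
  have hUd : U.det ≠ 0 := hG.det_ne_zero
  have hUV : Uᵀ * U = Vᵀ * V := by
    ext i j
    rw [transpose_polyWalkMatrix_mul_self hA, transpose_polyWalkMatrix_mul_self hB,
      map_dotProduct_pow, map_dotProduct_pow,
      dotProduct_pow_mulVec_one_eq h.1 h.charpoly_sub_eq]
  have hVd : V.det ≠ 0 := fun h0 => by
    have := congrArg det hUV
    rw [det_mul, det_mul, h0, mul_zero, det_transpose] at this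
    exact mul_ne_zero hUd hUd this
  have hVu : IsUnit V.det := isUnit_iff_ne_zero.2 hVd
  set Q := U * V⁻¹ with hQ
  have hQV : Q * V = U := by rw [hQ, Matrix.mul_assoc, nonsing_inv_mul _ hVu, Matrix.mul_one]
  have hQQ : Qᵀ * Q = 1 := by
    rw [hQ, transpose_mul, Matrix.mul_assoc, ← Matrix.mul_assoc Uᵀ, hUV, Matrix.mul_assoc,
      mul_nonsing_inv _ hVu, Matrix.mul_one, ← transpose_mul, mul_nonsing_inv _ hVu,
      transpose_one]
  have hmon : ∀ k, k < n → Q *ᵥ (B ^ k *ᵥ 1) = A ^ k *ᵥ 1 := fun k hk => by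
    ext i
    have := congrFun (congrFun hQV i) ⟨k, hk⟩
    simp only [Matrix.mul_apply, hU, hV, polyWalkMatrix, of_apply, aeval_X_pow] at this
    exact this
  have hlow : ∀ q : ℚ[X], q.degree < n → Q *ᵥ (aeval B q *ᵥ 1) = aeval A q *ᵥ 1 := fun q hq => by
    rcases eq_or_ne q 0 with rfl | h0
    · simp
    rw [q.as_sum_range' n ((natDegree_lt_iff_degree_lt h0).2 hq), map_sum, map_sum, sum_mulVec,
      sum_mulVec, mulVec_sum]
    refine Finset.sum_congr rfl fun k hk => ?_
    simp only [aeval_monomial, Algebra.algebraMap_eq_smul_one, smul_mul_assoc, one_mul, smul_mulVec,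
      mulVec_smul, hmon k (Finset.mem_range.1 hk)]
  have hpow : ∀ k, Q *ᵥ (B ^ k *ᵥ 1) = A ^ k *ᵥ 1 := fun k => by
    rw [pow_eq_aeval_mod_charpoly, pow_eq_aeval_mod_charpoly A, ← hχ]
    apply hlow
    have := degree_modByMonic_lt (X ^ k) A.charpoly_monic
    rwa [charpoly_degree_eq_dim, Fintype.card_fin] at this
  have hQe : Q *ᵥ 1 = 1 := by simpa using hpow 0
  -- On the last column of the walk matrix this needs the exponent `n`, supplied by reducing powers
  -- modulo the common characteristic polynomial.
  have hcomm : A * Q = Q * B := by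
    have h1 : A * Q * V = Q * B * V := by
      rw [Matrix.mul_assoc, hQV]
      ext i j
      calc (A * U) i j = (A *ᵥ (A ^ (j : ℕ) *ᵥ 1)) i := by
            simp only [Matrix.mul_apply, hU, polyWalkMatrix, of_apply, aeval_X_pow]; rfl
        _ = (Q *ᵥ (B ^ ((j : ℕ) + 1) *ᵥ 1)) i := by rw [hpow, mulVec_mulVec, pow_succ']
        _ = ((Q * B) *ᵥ (B ^ (j : ℕ) *ᵥ 1)) i := by
          simp only [pow_succ', mulVec_mulVec, Matrix.mul_assoc]
        _ = (Q * B * V) i j := by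
            simp only [Matrix.mul_apply, hV, polyWalkMatrix, of_apply, aeval_X_pow]; rfl
    have h2 := congrArg (· * V⁻¹) h1
    simpa only [Matrix.mul_assoc, mul_nonsing_inv _ hVu, Matrix.mul_one] using h2
  exact ⟨Q, hQQ, by rw [← hQe, mulVec_mulVec, hQQ, one_mulVec, hQe], hcomm⟩

theorem charpoly_eq_of_conj {n : ℕ} {M N : Matrix (Fin n) (Fin n) ℤ}
    {Q : Matrix (Fin n) (Fin n) ℚ} (hQ : Qᵀ * Q = 1)
    (h : Qᵀ * M.map (Int.castRingHom ℚ) * Q = N.map (Int.castRingHom ℚ)) :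
    M.charpoly = N.charpoly := by
  have hinj : Function.Injective (Int.castRingHom ℚ) := Int.cast_injective
  apply Polynomial.map_injective _ hinj
  rw [← charpoly_map, ← charpoly_map, ← h, charpoly_mul_comm, ← Matrix.mul_assoc,
    mul_eq_one_comm.1 hQ, Matrix.one_mul]

theorem transpose_mul_allOnes_mul {n : ℕ} {Q : Matrix (Fin n) (Fin n) ℚ} (hQe : Qᵀ *ᵥ 1 = 1) :
    Qᵀ * (Matrix.of fun _ _ => 1) * Q = Matrix.of fun _ _ => 1 := by
  have h : (Matrix.of fun _ _ => 1 : Matrix (Fin n) (Fin n) ℚ) = vecMulVec 1 1 := by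
    ext; simp [vecMulVec_apply]
  rw [h, mul_vecMulVec, hQe, vecMulVec_mul, ← mulVec_transpose, hQe]

theorem map_allOnes {n : ℕ} : (Matrix.of fun _ _ => 1 : Matrix (Fin n) (Fin n) ℤ).map
    (Int.castRingHom ℚ) = Matrix.of fun _ _ => 1 := by
  ext; simp

theorem genCospectral_of_orthogonal {n : ℕ} {G H : SimpleGraph (Fin n)}
    {Q : Matrix (Fin n) (Fin n) ℚ} (hQ : Qᵀ * Q = 1) (hQe : Qᵀ *ᵥ 1 = 1)
    (h : Qᵀ * adjRat G * Q = adjRat H) : GenCospectral G H := by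
  refine ⟨charpoly_eq_of_conj hQ h, charpoly_eq_of_conj hQ ?_⟩
  have key : ∀ G : SimpleGraph (Fin n), (adj Gᶜ).map (Int.castRingHom ℚ) =
      Matrix.of (fun _ _ => 1) - 1 - adjRat G := fun G => by
    rw [adj_compl, Matrix.map_sub _ (map_sub _), Matrix.map_sub _ (map_sub _), map_allOnes,
      Matrix.map_one _ (map_zero _) (map_one _)]
    rfl
  rw [key, key, mul_sub, mul_sub, sub_mul, sub_mul, transpose_mul_allOnes_mul hQe, h,
    Matrix.mul_one, hQ]

/-- `M_p` depends only on the characteristic polynomials of `A` and `A + J`, both preserved by `Q`,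
so the modified walk matrices of `G` and `H` use the same polynomials. -/
theorem modPoly_eq_of_orthogonal {n : ℕ} {G H : SimpleGraph (Fin n)}
    {Q : Matrix (Fin n) (Fin n) ℚ} (hQ : Qᵀ * Q = 1) (hQe : Qᵀ *ᵥ 1 = 1)
    (h : Qᵀ * adjRat G * Q = adjRat H) (p : ℕ) : modPoly G p = modPoly H p := by
  have h1 : (adj G).charpoly = (adj H).charpoly := charpoly_eq_of_conj hQ h
  have h2 : (adj G + Matrix.of fun _ _ => 1).charpoly =
      (adj H + Matrix.of fun _ _ => 1).charpoly := by
    refine charpoly_eq_of_conj hQ ?_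
    rw [Matrix.map_add _ (map_add _), Matrix.map_add _ (map_add _), map_allOnes, mul_add, add_mul,
      transpose_mul_allOnes_mul hQe, ← adjRat_eq, h, adjRat_eq]
  rw [modPoly, modPoly]
  split_ifs with h3 h4
  · rw [psi, psi, h1]
  · have : Fact p.Prime := ⟨h4⟩
    have e1 : ∀ G : SimpleGraph (Fin n), ((adj G).map (Int.cast : ℤ → ZMod p)).charpoly =
        (adj G).charpoly.map (Int.castRingHom (ZMod p)) := fun G =>
      charpoly_map (adj G) (Int.castRingHom (ZMod p))
    have e2 : ∀ G : SimpleGraph (Fin n),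
        ((adj G).map (Int.cast : ℤ → ZMod p) + Matrix.of fun _ _ => 1).charpoly =
        (adj G + Matrix.of fun _ _ => 1).charpoly.map (Int.castRingHom (ZMod p)) := fun G => by
      rw [← charpoly_map]
      congr 1
      ext; simp
    rw [mTilde, mTilde, e1, e1, e2, e2, h1, h2]
  · rfl

/-! ### The level of a rational orthogonal matrix divides `L` -/

theorem levelBound_ne_zero {n : ℕ} (G : SimpleGraph (Fin n)) : levelBound G ≠ 0 := by
  refine Finset.prod_ne_zero_iff.2 fun p hp => pow_ne_zero _ ?_
  simp only [potentialPrimes, Finset.mem_filter, Finset.mem_insert] at hp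
  rcases hp.1 with h | h
  · omega
  · exact (Nat.prime_of_mem_primeFactors h).ne_zero

theorem levelBound_cast_ne_zero {n : ℕ} (G : SimpleGraph (Fin n)) : (levelBound G : ℚ) ≠ 0 :=
  Nat.cast_ne_zero.2 (levelBound_ne_zero G)

theorem prime_of_mem_potentialPrimes {n : ℕ} {G : SimpleGraph (Fin n)} {p : ℕ}
    (hp : p ∈ potentialPrimes G) : p.Prime := by
  simp only [potentialPrimes, Finset.mem_filter, Finset.mem_insert] at hp
  rcases hp.1 with h | h
  · rw [h]; exact Nat.prime_two
  · exact Nat.prime_of_mem_primeFactors h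

theorem pow_tExp_dvd_levelBound {n : ℕ} {G : SimpleGraph (Fin n)} {p : ℕ}
    (hp : p ∈ potentialPrimes G) : p ^ tExp G p ∣ levelBound G :=
  Finset.dvd_prod_of_mem (fun p => p ^ tExp G p) hp

theorem den_dvd_of_mul_eq_int {q : ℚ} {N : ℕ} {y : ℤ} (h : (N : ℚ) * q = y) : q.den ∣ N := by
  have h1 : (N : ℤ) * q.num = y * q.den := by
    have h2 : (N : ℚ) * q.num = y * q.den := by
      rw [← h, mul_assoc, Rat.mul_den_eq_num]
    exact_mod_cast h2
  have h3 : (q.den : ℤ) ∣ N * q.num := ⟨y, by rw [h1, mul_comm]⟩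
  have h4 : IsCoprime (q.den : ℤ) q.num := by
    rw [Int.isCoprime_iff_gcd_eq_one, Int.gcd_comm]
    exact q.reduced
  exact_mod_cast h4.dvd_of_dvd_mul_right h3

/-- A rational matrix with bounded denominators is `1 / l` times an integral matrix that is
nonzero modulo all the primes that divide `l`. -/
theorem exists_level {m : Type*} {Q : Matrix m m ℚ} {N : ℕ} (hN : N ≠ 0)
    (hQ : ∃ Y : Matrix m m ℤ, ∀ i j, (N : ℚ) * Q i j = Y i j) :
    ∃ (l : ℕ) (Y : Matrix m m ℤ), (∀ i j, (l : ℚ) * Q i j = Y i j) ∧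
      ∀ p : ℕ, p.Prime → p ∣ l → ∃ i j, ¬ (p : ℤ) ∣ Y i j := by
  classical
  have hex : ∃ l : ℕ, l ≠ 0 ∧ ∃ Y : Matrix m m ℤ, ∀ i j, (l : ℚ) * Q i j = Y i j := ⟨N, hN, hQ⟩
  obtain ⟨hl0, Y, hY⟩ := Nat.find_spec hex
  refine ⟨_, Y, hY, fun p hp hpl => ?_⟩
  by_contra! hcon
  obtain ⟨k, hk⟩ := hpl
  choose Z hZ using hcon
  have hk0 : k ≠ 0 := fun h => hl0 (by rw [hk, h, mul_zero])
  -- The least common denominator is taken: were the whole matrix divisible by `p`, the smaller `l /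
  -- p` would also do.
  refine Nat.find_min hex (m := k) ?_ ⟨hk0, Matrix.of Z, fun i j => ?_⟩
  · rw [hk]
    exact lt_mul_of_one_lt_left (Nat.pos_of_ne_zero hk0) hp.one_lt
  · have h1 := hY i j
    rw [hk, hZ i j] at h1
    push_cast at h1
    rw [mul_assoc] at h1
    exact mul_left_cancel₀ (Nat.cast_ne_zero.2 hp.ne_zero) h1

section Orthogonal

variable {n : ℕ} {G H : SimpleGraph (Fin n)} {Q : Matrix (Fin n) (Fin n) ℚ}

theorem transpose_mul_adjRat_mul (hQ : Qᵀ * Q = 1) (h : adjRat G * Q = Q * adjRat H) :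
    Qᵀ * adjRat G * Q = adjRat H := by
  rw [Matrix.mul_assoc, h, ← Matrix.mul_assoc, hQ, Matrix.one_mul]

theorem adjRat_mul_eq (hQ : Qᵀ * Q = 1) (h : Qᵀ * adjRat G * Q = adjRat H) :
    adjRat G * Q = Q * adjRat H := by
  rw [← h, ← Matrix.mul_assoc, ← Matrix.mul_assoc, mul_eq_one_comm.1 hQ, Matrix.one_mul]

theorem transpose_walkMatrix_mul (hQe : Qᵀ *ᵥ 1 = 1) (h : adjRat G * Q = Q * adjRat H) :
    ((walkMatrix G).map (Int.cast : ℤ → ℚ))ᵀ * Q = ((walkMatrix H).map (Int.cast : ℤ → ℚ))ᵀ := by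
  rw [map_walkMatrix, map_walkMatrix,
    ← transpose_mul_polyWalkMatrix h (adjRat_isSymm G) (adjRat_isSymm H) hQe, transpose_mul,
    transpose_transpose]

theorem transpose_modifiedWalkMatrix_mul (hQ : Qᵀ * Q = 1) (hQe : Qᵀ *ᵥ 1 = 1)
    (h : adjRat G * Q = Q * adjRat H) {p : ℕ} (hp : p.Prime) :
    ((modifiedWalkMatrix G p).map (Int.cast : ℤ → ℚ))ᵀ * Q =
      ((modifiedWalkMatrix H p).map (Int.cast : ℤ → ℚ))ᵀ := by
  have hM := modPoly_eq_of_orthogonal hQ hQe (transpose_mul_adjRat_mul hQ h) p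
  have hP : walkPoly G p = walkPoly H p := by
    funext j
    rw [walkPoly, walkPoly, modPolyInt, modPolyInt, hM]
  rw [map_modifiedWalkMatrix G hp, map_modifiedWalkMatrix H hp, ← hP,
    ← transpose_mul_polyWalkMatrix h (adjRat_isSymm G) (adjRat_isSymm H) hQe, transpose_mul,
    transpose_transpose]

theorem exists_int_lastInvariantFactor_mul {M N : Matrix (Fin n) (Fin n) ℤ}
    (h : (M.map (Int.cast : ℤ → ℚ))ᵀ * Q = (N.map (Int.cast : ℤ → ℚ))ᵀ) :
    ∃ Y : Matrix (Fin n) (Fin n) ℤ, ∀ i j, (lastInvariantFactor M : ℚ) * Q i j = Y i j := by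
  have key : ∀ j, ∃ y : Fin n → ℤ, ∀ i, (lastInvariantFactor M : ℚ) * Q i j = y i := fun j =>
    exists_int_lastInvariantFactor_smul M (fun i => Q i j) (fun i => N j i) (by
      ext i
      exact congrFun (congrFun h i) j)
  choose y hy using key
  exact ⟨Matrix.of fun i j => y j i, fun i j => hy j i⟩

theorem sq_dvd_discriminant (hG : Controllable G) (hQ : Qᵀ * Q = 1) (hQe : Qᵀ *ᵥ 1 = 1)
    (h : adjRat G * Q = Q * adjRat H) {p : ℕ} (hp : p.Prime) {i j : Fin n}
    (hd : p ∣ (Q i j).den) : (p : ℤ) ^ 2 ∣ discriminant G := by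
  obtain ⟨l, Y, hY, hYp⟩ := exists_level (lastInvariantFactor_ne_zero hG.det_walkMatrix_ne_zero)
    (exists_int_lastInvariantFactor_mul (transpose_walkMatrix_mul hQe h))
  have hpl : p ∣ l := hd.trans (den_dvd_of_mul_eq_int (hY i j))
  obtain ⟨a, b, hab⟩ := hYp p hp hpl
  have hYQ : Y.map (Int.castRingHom ℚ) = (l : ℚ) • Q := by
    ext i j; simp [← hY]
  have hinj : Function.Injective fun M : Matrix (Fin n) (Fin n) ℤ => M.map (Int.castRingHom ℚ) :=
    Matrix.map_injective Int.cast_injective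
  have hmul : ∀ M N : Matrix (Fin n) (Fin n) ℤ, (M * N).map (Int.castRingHom ℚ) =
      M.map (Int.castRingHom ℚ) * N.map (Int.castRingHom ℚ) := fun M N => Matrix.map_mul
  refine sq_dvd_discr_charpoly (A := adj G) (B := adj H) (Q := Y) (l := l) (adj_isSymm G) hp
    (by exact_mod_cast hpl) (hinj ?_) (hinj ?_) hab
  · simp only [hmul, hYQ, ← adjRat_eq, Matrix.mul_smul, Matrix.smul_mul, h]
  · simp only [hmul, transpose_map, hYQ, transpose_smul, Matrix.mul_smul, Matrix.smul_mul, hQ]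
    ext a b
    rw [map_apply, Matrix.smul_apply, Matrix.smul_apply, Matrix.smul_apply]
    by_cases hab : a = b
    · subst hab
      rw [one_apply_eq, one_apply_eq]
      simp [sq]
    · rw [one_apply_ne hab, one_apply_ne hab]
      simp

/-- The level of `Q` divides `L`. -/
theorem exists_int_levelBound_mul (hG : Controllable G) (hQ : Qᵀ * Q = 1) (hQe : Qᵀ *ᵥ 1 = 1)
    (h : adjRat G * Q = Q * adjRat H) (i j : Fin n) :
    ∃ x : ℤ, (levelBound G : ℚ) * Q i j = x := by
  suffices hd : (Q i j).den ∣ levelBound G by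
    obtain ⟨k, hk⟩ := hd
    refine ⟨k * (Q i j).num, ?_⟩
    rw [hk]
    push_cast
    rw [mul_right_comm, mul_comm ((Q i j).den : ℚ), Rat.mul_den_eq_num, mul_comm]
  rw [Nat.dvd_iff_prime_pow_dvd_dvd]
  intro p k hp hpk
  rcases Nat.eq_zero_or_pos k with hk | hk
  · simp [hk]
  have : Fact p.Prime := ⟨hp⟩
  have hpd : p ∣ (Q i j).den := (dvd_pow_self p hk.ne').trans hpk
  obtain ⟨Y, hY⟩ := exists_int_lastInvariantFactor_mul
    (transpose_modifiedWalkMatrix_mul hQ hQe h hp)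
  have hkt : k ≤ tExp G p := (padicValNat_dvd_iff_le (lastInvariantFactor_ne_zero
    (hG.det_modifiedWalkMatrix_ne_zero hp))).1 (hpk.trans (den_dvd_of_mul_eq_int (hY i j)))
  obtain ⟨Z, hZ⟩ := exists_int_lastInvariantFactor_mul (transpose_walkMatrix_mul hQe h)
  have hpw : p ∣ lastInvariantFactor (walkMatrix G) := hpd.trans (den_dvd_of_mul_eq_int (hZ i j))
  have hdisc := sq_dvd_discriminant hG hQ hQe h hp hpd
  -- The discriminant argument covers `p = 2` as well, so no case distinction is needed.
  have hmem : p ∈ potentialPrimes G := by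
    simp only [potentialPrimes, Finset.mem_filter, Finset.mem_insert]
    refine ⟨Or.inr ?_, Or.inr hdisc, le_trans hk hkt⟩
    rw [Nat.mem_primeFactors]
    refine ⟨hp, Int.dvd_coe_gcd ((dvd_pow_self _ two_ne_zero).trans hdisc)
      (by exact_mod_cast hpw) |> Int.natCast_dvd_natCast.1, fun h0 => ?_⟩
    have := (Int.gcd_eq_zero_iff.1 h0).2
    exact lastInvariantFactor_ne_zero hG.det_walkMatrix_ne_zero (by exact_mod_cast this)
  exact (pow_dvd_pow p hkt).trans (pow_tExp_dvd_levelBound hmem)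

end Orthogonal

/-! ### Cliques of order `n` and generalized cospectral graphs -/

section Cliques

variable {n : ℕ} {G H H' : SimpleGraph (Fin n)}

theorem transpose_cliqueMatrix_mul (ξ : Fin n → OmegaVertex G) (k l : Fin n) :
    ((cliqueMatrix G ξ)ᵀ * cliqueMatrix G ξ) k l =
      (((ξ k).1 ⬝ᵥ (ξ l).1 : ℤ) : ℚ) / (levelBound G : ℚ) ^ 2 := by
  simp only [Matrix.mul_apply, transpose_apply, cliqueMatrix, of_apply, dotProduct, Int.cast_sum,
    Int.cast_mul, Finset.sum_div]
  exact Finset.sum_congr rfl fun i _ => by rw [div_mul_div_comm, sq]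

theorem transpose_cliqueMatrix_mulVec_one (ξ : Fin n → OmegaVertex G) :
    (cliqueMatrix G ξ)ᵀ *ᵥ 1 = 1 := by
  ext k
  have h := (ξ k).2.2.2.1
  have h2 : ((cliqueMatrix G ξ)ᵀ *ᵥ 1) k =
      (((1 : Fin n → ℤ) ⬝ᵥ (ξ k).1 : ℤ) : ℚ) / (levelBound G : ℚ) := by
    simp [mulVec, cliqueMatrix, dotProduct, Finset.sum_div]
  rw [h2, h, Int.cast_natCast, div_self (levelBound_cast_ne_zero G), Pi.one_apply]

theorem transpose_cliqueMatrix_mul_adjRat_mul (ξ : Fin n → OmegaVertex G) (k l : Fin n) :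
    ((cliqueMatrix G ξ)ᵀ * adjRat G * cliqueMatrix G ξ) k l =
      (((ξ k).1 ⬝ᵥ (adj G *ᵥ (ξ l).1) : ℤ) : ℚ) / (levelBound G : ℚ) ^ 2 := by
  rw [Matrix.mul_assoc]
  simp only [Matrix.mul_apply, transpose_apply, cliqueMatrix, of_apply, dotProduct, mulVec,
    Int.cast_sum, Int.cast_mul, Finset.sum_div, Finset.mul_sum, adjRat, map_apply]
  exact Finset.sum_congr rfl fun i _ => Finset.sum_congr rfl fun j _ => by ring

theorem cliqueMatrix_injective {ξ η : Fin n → OmegaVertex G}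
    (h : cliqueMatrix G ξ = cliqueMatrix G η) : ξ = η := by
  funext k
  refine Subtype.ext (funext fun i => ?_)
  have h1 := congrFun (congrFun h i) k
  simp only [cliqueMatrix, of_apply] at h1
  exact_mod_cast (div_left_inj' (levelBound_cast_ne_zero G)).1 h1

theorem transpose_cliqueMatrix_mul_self {K : Finset (OmegaVertex G)}
    (hK : (Omega G).IsClique (K : Set (OmegaVertex G))) (ξ : Fin n ≃ {x // x ∈ K}) :
    (cliqueMatrix G fun k => (ξ k).1)ᵀ * cliqueMatrix G (fun k => (ξ k).1) = 1 := by
  ext k l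
  rw [transpose_cliqueMatrix_mul]
  by_cases h : k = l
  · subst h
    rw [(ξ k).1.2.2.1, one_apply_eq, Int.cast_pow, Int.cast_natCast,
      div_self (pow_ne_zero _ (levelBound_cast_ne_zero G))]
  · have hne : (ξ k).1 ≠ (ξ l).1 := fun h' => h (ξ.injective (Subtype.ext h'))
    have hadj : (Omega G).Adj (ξ k).1 (ξ l).1 := hK (ξ k).2 (ξ l).2 hne
    rw [hadj.2.1, one_apply_ne h]
    simp

/-- The Gram matrix of a clique is `L²` times the identity, hence invertible, and its rank is at
most `n`. -/
theorem card_le_of_isClique {K : Finset (OmegaVertex G)}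
    (hK : (Omega G).IsClique (K : Set (OmegaVertex G))) : K.card ≤ n := by
  let Y : Matrix {x // x ∈ K} (Fin n) ℚ := Matrix.of fun x i => (x.1.1 i : ℚ)
  have hY : Y * Yᵀ = ((levelBound G : ℚ) ^ 2) • (1 : Matrix {x // x ∈ K} {x // x ∈ K} ℚ) := by
    ext x y
    have h1 : (Y * Yᵀ) x y = ((x.1.1 ⬝ᵥ y.1.1 : ℤ) : ℚ) := by
      simp [Matrix.mul_apply, Y, dotProduct]
    rw [h1, Matrix.smul_apply, smul_eq_mul]
    by_cases h : x = y
    · subst h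
      rw [x.1.2.2.1]
      simp
    · have hadj : (Omega G).Adj x.1 y.1 := hK x.2 y.2 fun h' => h (Subtype.ext h')
      rw [hadj.2.1, one_apply_ne h]
      simp
  have hu : IsUnit (Y * Yᵀ) := by
    rw [hY, Matrix.isUnit_iff_isUnit_det, det_smul, det_one, mul_one]
    exact (isUnit_iff_ne_zero.2 (pow_ne_zero _ (levelBound_cast_ne_zero G))).pow _
  have h1 := rank_of_isUnit _ hu
  have h2 := (rank_mul_le_left Y Yᵀ).trans (rank_le_card_width Y)
  rw [h1, Fintype.card_coe, Fintype.card_fin] at h2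
  exact h2

/-- The clique `K` of `Ω(G)`, suitably ordered, gives the graph `H`. -/
def Represents (K : Finset (OmegaVertex G)) (H : SimpleGraph (Fin n)) : Prop :=
  ∃ ξ : Fin n ≃ {x // x ∈ K}, (cliqueMatrix G fun k => (ξ k).1)ᵀ * adjRat G *
    (cliqueMatrix G fun k => (ξ k).1) = adjRat H

theorem adjRat_apply_eq_one_iff (H : SimpleGraph (Fin n)) (k l : Fin n) :
    adjRat H k l = 1 ↔ H.Adj k l := by
  by_cases h : H.Adj k l <;> simp [adjRat, adj, h]

/-- The entries of `Qᵀ A Q` are `ξᵀ A η / L²`: adjacency in `Ω(G)` makes them 0 or 1, and the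
equation `xᵀ A x = 0` gives the zero diagonal. -/
theorem exists_represents {K : Finset (OmegaVertex G)} (hK : (Omega G).IsNClique n K) :
    ∃ H, Represents K H := by
  have hL := levelBound_cast_ne_zero G
  have e : Fin n ≃ {x // x ∈ K} := (finCongr hK.card_eq.symm).trans K.equivFin.symm
  set M := (cliqueMatrix G fun k => (e k).1)ᵀ * adjRat G * (cliqueMatrix G fun k => (e k).1)
    with hM
  have hsymm : M.IsSymm := by
    rw [Matrix.IsSymm, hM, transpose_mul, transpose_mul, transpose_transpose,
      (adjRat_isSymm G).eq, Matrix.mul_assoc]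
  have hdiag : ∀ k, M k k = 0 := fun k => by
    rw [hM, transpose_cliqueMatrix_mul_adjRat_mul, (e k).1.2.2.2.2]
    simp
  have h01 : ∀ k l, M k l = 0 ∨ M k l = 1 := fun k l => by
    by_cases h : k = l
    · exact Or.inl (h ▸ hdiag k)
    have hne : (e k).1 ≠ (e l).1 := fun h' => h (e.injective (Subtype.ext h'))
    have hadj : (Omega G).Adj (e k).1 (e l).1 := hK.isClique (e k).2 (e l).2 hne
    rw [hM, transpose_cliqueMatrix_mul_adjRat_mul]
    rcases hadj.2.2 with h0 | h1
    · left; rw [h0]; simp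
    · right
      rw [h1, Int.cast_pow, Int.cast_natCast, div_self (pow_ne_zero _ hL)]
  let H : SimpleGraph (Fin n) :=
    { Adj := fun k l => M k l = 1
      symm := ⟨fun k l h => by rw [hsymm.apply]; exact h⟩
      loopless := ⟨fun k h => by rw [hdiag] at h; exact zero_ne_one h⟩ }
  refine ⟨H, e, ?_⟩
  rw [← hM]
  ext k l
  rcases h01 k l with h | h
  · have : ¬ H.Adj k l := fun h' => zero_ne_one (h.symm.trans h')
    rw [h]
    simp [adjRat, adj, this]
  · rw [h, (adjRat_apply_eq_one_iff H k l).2 h]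

theorem Represents.genCospectral {K : Finset (OmegaVertex G)}
    (hK : (Omega G).IsClique (K : Set (OmegaVertex G))) (h : Represents K H) :
    GenCospectral G H := by
  obtain ⟨ξ, hξ⟩ := h
  exact genCospectral_of_orthogonal (transpose_cliqueMatrix_mul_self hK ξ)
    (transpose_cliqueMatrix_mulVec_one _) hξ

theorem Represents.of_iso {K : Finset (OmegaVertex G)} (h : Represents K H) (e : H ≃g H') :
    Represents K H' := by
  obtain ⟨ξ, hξ⟩ := h
  refine ⟨e.symm.toEquiv.trans ξ, ?_⟩
  ext k l
  have h1 := congrFun (congrFun hξ (e.symm k)) (e.symm l)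
  rw [transpose_cliqueMatrix_mul_adjRat_mul] at h1 ⊢
  have h2 : adjRat H (e.symm k) (e.symm l) = adjRat H' k l := by
    by_cases h : H'.Adj k l
    · rw [(adjRat_apply_eq_one_iff H' k l).2 h, adjRat_apply_eq_one_iff]
      exact e.symm.map_adj_iff.2 h
    · have h' : ¬ H.Adj (e.symm k) (e.symm l) := fun h' => h (e.symm.map_adj_iff.1 h')
      simp only [adjRat, adj, map_apply, SimpleGraph.adjMatrix_apply, if_neg h, if_neg h']
  rw [← h2]
  exact h1

/-- Both adjacency matrices list the numbers `ξᵀ A η / L²` over the same set `K`, only in different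
orders. -/
theorem Represents.iso {K : Finset (OmegaVertex G)} (h : Represents K H) (h' : Represents K H') :
    Nonempty (H ≃g H') := by
  obtain ⟨ξ, hξ⟩ := h
  obtain ⟨η, hη⟩ := h'
  refine ⟨⟨ξ.trans η.symm, fun {k l} => ?_⟩⟩
  rw [← adjRat_apply_eq_one_iff H, ← adjRat_apply_eq_one_iff H', ← hξ, ← hη,
    transpose_cliqueMatrix_mul_adjRat_mul, transpose_cliqueMatrix_mul_adjRat_mul]
  simp

/-- Any ordered clique giving `H` has `Qᵀ = W(H) W(G)⁻¹`, which does not involve the clique. -/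
theorem Represents.unique (hG : Controllable G) {K K' : Finset (OmegaVertex G)}
    (hK : (Omega G).IsClique (K : Set (OmegaVertex G)))
    (hK' : (Omega G).IsClique (K' : Set (OmegaVertex G)))
    (h : Represents K H) (h' : Represents K' H) : K = K' := by
  obtain ⟨ξ, hξ⟩ := h
  obtain ⟨η, hη⟩ := h'
  have key : ∀ {K : Finset (OmegaVertex G)} (_ : (Omega G).IsClique (K : Set (OmegaVertex G)))
      (ξ : Fin n ≃ {x // x ∈ K}), (cliqueMatrix G fun k => (ξ k).1)ᵀ * adjRat G *
        (cliqueMatrix G fun k => (ξ k).1) = adjRat H →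
      (cliqueMatrix G fun k => (ξ k).1)ᵀ = polyWalkMatrix (adjRat H) (fun j => X ^ (j : ℕ)) *
        (polyWalkMatrix (adjRat G) fun j => X ^ (j : ℕ))⁻¹ := fun hK ξ hξ => by
    rw [← transpose_mul_polyWalkMatrix (adjRat_mul_eq (transpose_cliqueMatrix_mul_self hK ξ) hξ)
      (adjRat_isSymm G) (adjRat_isSymm H) (transpose_cliqueMatrix_mulVec_one _),
      Matrix.mul_assoc, mul_nonsing_inv _ (isUnit_iff_ne_zero.2 hG.det_ne_zero), Matrix.mul_one]
  have hQ := cliqueMatrix_injective (transpose_injective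
    ((key hK ξ hξ).trans (key hK' η hη).symm))
  ext x
  constructor
  · intro hx
    have := congrFun hQ (ξ.symm ⟨x, hx⟩)
    rw [Equiv.apply_symm_apply] at this
    exact (show x = _ from this) ▸ (η _).2
  · intro hx
    have := congrFun hQ (η.symm ⟨x, hx⟩)
    rw [Equiv.apply_symm_apply] at this
    exact (show _ = x from this) ▸ (ξ _).2

/-- The clique consists of the columns of `L Q`, integral by `exists_int_levelBound_mul`. -/
theorem GenCospectral.exists_represents (hG : Controllable G) (h : GenCospectral G H) :
    ∃ K, (Omega G).IsNClique n K ∧ Represents K H := by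
  obtain ⟨Q, hQ, hQe, hAQ⟩ := h.exists_orthogonal hG
  have hL := levelBound_cast_ne_zero G
  have hB := transpose_mul_adjRat_mul hQ hAQ
  choose x hx using fun k i => exists_int_levelBound_mul hG hQ hQe hAQ i k
  have hdot : ∀ k l, x k ⬝ᵥ x l = (levelBound G : ℤ) ^ 2 * (1 : Matrix (Fin n) (Fin n) ℤ) k l := by
    intro k l
    have h1 := congrFun (congrFun hQ k) l
    have h2 : (((x k ⬝ᵥ x l : ℤ)) : ℚ) = (levelBound G : ℚ) ^ 2 * (Qᵀ * Q) k l := by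
      simp only [dotProduct, Int.cast_sum, Int.cast_mul, ← hx, Matrix.mul_apply, transpose_apply,
        Finset.mul_sum]
      exact Finset.sum_congr rfl fun i _ => by ring
    rw [h1] at h2
    by_cases hkl : k = l
    · subst hkl
      rw [one_apply_eq] at h2 ⊢
      exact_mod_cast h2
    · rw [one_apply_ne hkl] at h2 ⊢
      exact_mod_cast h2
  have hadj : ∀ k l, x k ⬝ᵥ (adj G *ᵥ x l) = (levelBound G : ℤ) ^ 2 * adj H k l := by
    intro k l
    have h1 := congrFun (congrFun hB k) l
    have h2 : (((x k ⬝ᵥ (adj G *ᵥ x l) : ℤ)) : ℚ) =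
        (levelBound G : ℚ) ^ 2 * (Qᵀ * adjRat G * Q) k l := by
      rw [Matrix.mul_assoc]
      simp only [dotProduct, mulVec, Int.cast_sum, Int.cast_mul, ← hx, Matrix.mul_apply,
        transpose_apply, Finset.mul_sum, adjRat, map_apply]
      exact Finset.sum_congr rfl fun i _ => Finset.sum_congr rfl fun j _ => by ring
    rw [h1, adjRat, map_apply] at h2
    exact_mod_cast h2
  have hsum : ∀ k, (1 : Fin n → ℤ) ⬝ᵥ x k = levelBound G := by
    intro k
    have h1 := congrFun hQe k
    have h2 : (((1 : Fin n → ℤ) ⬝ᵥ x k : ℤ) : ℚ) = (levelBound G : ℚ) * (Qᵀ *ᵥ 1) k := by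
      simp [dotProduct, mulVec, ← hx, Finset.mul_sum]
    rw [h1, Pi.one_apply, mul_one] at h2
    exact_mod_cast h2
  -- `W^(p)(G)ᵀ (L Q) = L W^(p)(H)ᵀ`, and `p ^ t_p` divides `L`.
  have hcong : ∀ k, ∀ p ∈ potentialPrimes G, ∀ j,
      (p : ℤ) ^ tExp G p ∣ ((modifiedWalkMatrix G p)ᵀ *ᵥ x k) j := by
    intro k p hp j
    have h1 := congrFun (congrFun (transpose_modifiedWalkMatrix_mul hQ hQe hAQ
      (prime_of_mem_potentialPrimes hp)) j) k
    have h2 : ((((modifiedWalkMatrix G p)ᵀ *ᵥ x k) j : ℤ) : ℚ) = (levelBound G : ℚ) *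
        (((modifiedWalkMatrix G p).map (Int.cast : ℤ → ℚ))ᵀ * Q) j k := by
      simp only [dotProduct, mulVec, Int.cast_sum, Int.cast_mul, ← hx, Matrix.mul_apply,
        transpose_apply, Finset.mul_sum, map_apply]
      exact Finset.sum_congr rfl fun i _ => by ring
    rw [h1, transpose_apply, map_apply] at h2
    have h3 : ((modifiedWalkMatrix G p)ᵀ *ᵥ x k) j =
        (levelBound G : ℤ) * modifiedWalkMatrix H p k j := by exact_mod_cast h2
    rw [h3]
    exact Dvd.dvd.mul_right (by exact_mod_cast pow_tExp_dvd_levelBound hp) _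
  let ξ : Fin n → OmegaVertex G := fun k => ⟨x k, hcong k, by rw [hdot, one_apply_eq, mul_one],
    hsum k, by rw [hadj, adj_diag, mul_zero]⟩
  have hLz : (levelBound G : ℤ) ^ 2 ≠ 0 :=
    pow_ne_zero _ (Int.natCast_ne_zero.2 (levelBound_ne_zero G))
  have hinj : Function.Injective ξ := fun k l hkl => by
    by_contra hne
    have h1 : x k = x l := congrArg Subtype.val hkl
    have h2 := hdot k l
    rw [one_apply_ne hne, mul_zero, ← h1, hdot, one_apply_eq, mul_one] at h2
    exact hLz h2
  have hQξ : cliqueMatrix G ξ = Q := by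
    ext i k
    rw [cliqueMatrix, of_apply, div_eq_iff hL, mul_comm]
    exact (hx k i).symm
  refine ⟨Finset.univ.map ⟨ξ, hinj⟩, ⟨?_, by simp⟩,
    Equiv.ofBijective (fun k => ⟨ξ k, Finset.mem_map_of_mem ⟨ξ, hinj⟩ (Finset.mem_univ k)⟩)
      ⟨fun k l h => hinj (congrArg Subtype.val h), ?_⟩, ?_⟩
  · intro a ha b hb hab
    obtain ⟨k, -, rfl⟩ := Finset.mem_map.1 (Finset.mem_coe.1 ha)
    obtain ⟨l, -, rfl⟩ := Finset.mem_map.1 (Finset.mem_coe.1 hb)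
    have hkl : k ≠ l := fun h => hab (by rw [h])
    refine ⟨hab, ?_, ?_⟩
    · change x k ⬝ᵥ x l = 0
      rw [hdot, one_apply_ne hkl, mul_zero]
    · change x k ⬝ᵥ (adj G *ᵥ x l) = 0 ∨ x k ⬝ᵥ (adj G *ᵥ x l) = (levelBound G : ℤ) ^ 2
      rw [hadj]
      by_cases h : H.Adj k l <;> simp [adj, h]
  · rintro ⟨a, ha⟩
    obtain ⟨k, -, rfl⟩ := Finset.mem_map.1 ha
    exact ⟨k, rfl⟩
  · change (cliqueMatrix G ξ)ᵀ * adjRat G * cliqueMatrix G ξ = adjRat H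
    rw [hQξ, hB]

theorem isMaximumClique_iff_isNClique (hG : Controllable G) (K : Finset (OmegaVertex G)) :
    (Omega G).IsMaximumClique K ↔ (Omega G).IsNClique n K := by
  constructor
  · intro h
    -- `G` is generalized cospectral with itself, so the upper bound `n` is attained.
    obtain ⟨K₀, hK₀, -⟩ := GenCospectral.exists_represents (H := G) hG ⟨rfl, rfl⟩
    exact ⟨h.isClique, le_antisymm (card_le_of_isClique h.isClique)
      (hK₀.card_eq.symm.trans_le (h.maximum K₀ hK₀.isClique))⟩
  · intro h
    exact ⟨h.isClique, fun t ht => (card_le_of_isClique ht).trans_eq h.card_eq.symm⟩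

theorem unlabel_eq_iff : unlabel H = unlabel H' ↔ Nonempty (H ≃g H') := Quotient.eq

theorem GenCospectral.order_eq {m : ℕ} {H : SimpleGraph (Fin m)} (h : GenCospectral G H) :
    m = n := by
  have := congrArg natDegree h.1
  rw [charpoly_natDegree_eq_dim, charpoly_natDegree_eq_dim, Fintype.card_fin,
    Fintype.card_fin] at this
  exact this.symm

end Cliques

end GenSpec

theorem mainTheorem1 {n : ℕ} (G : SimpleGraph (Fin n)) (hG : GenSpec.Controllable G) :
    (∀ K : Finset (GenSpec.OmegaVertex G),
      (GenSpec.Omega G).IsMaximumClique K ↔ (GenSpec.Omega G).IsNClique n K) ∧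
    ∃ φ : GenSpec.MaximumClique G ≃ GenSpec.cospectralClasses G,
      ∀ (K : GenSpec.MaximumClique G) (H : SimpleGraph (Fin n)),
        (φ K : GenSpec.UnlabeledGraph) = GenSpec.unlabel H ↔
          ∃ ξ : Fin n ≃ {x // x ∈ K.1},
            (GenSpec.cliqueMatrix G fun k => (ξ k).1)ᵀ * GenSpec.adjRat G *
              (GenSpec.cliqueMatrix G fun k => (ξ k).1) = GenSpec.adjRat H := by
  have hmax := GenSpec.isMaximumClique_iff_isNClique hG
  refine ⟨hmax, ?_⟩
  choose H hH using fun K : GenSpec.MaximumClique G =>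
    GenSpec.exists_represents ((hmax K.1).1 K.2)
  have hiff : ∀ (K : GenSpec.MaximumClique G) (H' : SimpleGraph (Fin n)),
      GenSpec.unlabel (H K) = GenSpec.unlabel H' ↔ GenSpec.Represents K.1 H' := fun K H' => by
    rw [GenSpec.unlabel_eq_iff]
    exact ⟨fun ⟨e⟩ => (hH K).of_iso e, fun h => (hH K).iso h⟩
  let f : GenSpec.MaximumClique G → GenSpec.cospectralClasses G := fun K =>
    ⟨GenSpec.unlabel (H K), n, H K, rfl, (hH K).genCospectral K.2.isClique⟩
  have hf : Function.Bijective f := by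
    constructor
    · intro K K' h
      have h1 : GenSpec.unlabel (H K) = GenSpec.unlabel (H K') := congrArg Subtype.val h
      -- Equal classes make both cliques represent the same labeled graph `H K'`, where uniqueness
      -- applies.
      exact Subtype.ext (((hiff K _).1 h1).unique hG K.2.isClique K'.2.isClique (hH K'))
    · rintro ⟨_, m, H', rfl, hH'⟩
      obtain rfl := hH'.order_eq
      obtain ⟨K, hK, hKH⟩ := hH'.exists_represents hG
      exact ⟨⟨K, (hmax K).2 hK⟩, Subtype.ext ((hiff ⟨K, (hmax K).2 hK⟩ H').2 hKH)⟩
  exact ⟨Equiv.ofBijective f hf, hiff⟩
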